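/- Let $q\in\mathbb C$ with $0<|q|<1$, and write $(a)_\infty=\prod_{j=0}^\infty(1-aq^j)$ and $\theta(x)=(x)_\infty(q/x)_\infty$. Let $a_1,a_2,a_3,b_1,b_2,b_3,\lambda_1,\lambda_2,\lambda_3$ be non-zero complex numbers subject to $$\lambda_1\lambda_2\lambda_3=qa_1a_2a_3=\frac{q^2}{b_1b_2b_3},$$ which are generic in the sense that $a_ib_jq^k\neq 1$ for all $1\le i,j\le 3$ and all integers $k\ge 0$, and $\lambda_1/\lambda_2\notin q^{\mathbb Z}$. Then $$\oint \prod_{j=1}^3\frac{\theta(\lambda_jz)}{(a_jz)_\infty(b_j/z)_\infty}\,\frac{dz}{2\pi \mathrm i z} =\frac{\prod_{j=1}^3\theta(\lambda_1/a_j)\theta(\lambda_2b_j)-\dfrac{\lambda_1}{\lambda_2}\prod_{j=1}^3\theta(\lambda_1b_j)\theta(\lambda_2/a_j)}{(q)_\infty\,\theta(\lambda_1/\lambda_2)\prod_{i,j=1}^3(a_ib_j)_\infty}.$$ Here the integration is over any positively oriented, piecewise $C^1$ closed contour in $\mathbb C\setminus\{0\}$ that separates the points $b_jq^k$ from the points $a_j^{-1}q^{-k}$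 ($1\le j\le 3$, $k\ge 0$): it avoids all these points and has winding number $1$ around $0$ and around each $b_jq^k$, and winding number $0$ around each $a_j^{-1}q^{-k}$. -/

import Mathlib

/-- The infinite `q`-shifted factorial `(a)_∞ = ∏_{j ≥ 0} (1 - a q^j)`. -/
noncomputable def qPochInf (q a : ℂ) : ℂ := ∏' j : ℕ, (1 - a * q ^ j)

/-- The theta function `θ(x) = (x)_∞ (q/x)_∞`. -/
noncomputable def qTheta (q x : ℂ) : ℂ := qPochInf q x * qPochInf q (q / x)

/-- The contour integral `∫_γ f(z) dz = ∫_0^1 f(γ(t)) γ'(t) dt`, as the integral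
along `γ` of the 1-form `f(z) dz`. -/
noncomputable def contourIntegral (f : ℂ → ℂ) {p p' : ℂ} (γ : Path p p') : ℂ :=
  curveIntegral (fun z => ContinuousLinearMap.toSpanSingleton ℂ (f z)) γ

/-- The winding number of a closed path around `w`, as a complex number. -/
noncomputable def windingNumber {p : ℂ} (γ : Path p p) (w : ℂ) : ℂ :=
  (2 * Real.pi * Complex.I)⁻¹ * contourIntegral (fun z => (z - w)⁻¹) γ

/-- A path is piecewise `C^1`: there is a subdivision `0 = s_0 ≤ s_1 ≤ ⋯ ≤ s_n = 1` such
that the path is continuously differentiable on each closed piece. -/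
def IsPiecewiseC1 {p p' : ℂ} (γ : Path p p') : Prop :=
  ∃ (n : ℕ) (s : ℕ → ℝ), Monotone s ∧ s 0 = 0 ∧ s n = 1 ∧
    ∀ i < n, ContDiffOn ℝ 1 γ.extend (Set.Icc (s i) (s (i + 1)))

/-- `γ` is a positively oriented closed contour in `ℂ \ {0}` that separates the poles
`b_j q^k` (`k ≥ 0`), which tend to the origin and lie inside together with the origin, from the
poles `a_j⁻¹ q^{-k}` (`k ≥ 0`), which tend to infinity and lie outside. The inside is where the
winding number is `1`, the outside is where it is `0`. -/
structure IsSeparatingContour (q : ℂ) (a b : Fin 3 → ℂ) {p : ℂ} (γ : Path p p) : Prop where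
  piecewiseC1 : IsPiecewiseC1 γ
  ne_zero : ∀ t, γ t ≠ 0
  ne_inner : ∀ (j : Fin 3) (k : ℕ) t, γ t ≠ b j * q ^ k
  ne_outer : ∀ (j : Fin 3) (k : ℕ) t, γ t ≠ (a j)⁻¹ * (q ^ k)⁻¹
  winding_zero : windingNumber γ 0 = 1
  winding_inner : ∀ (j : Fin 3) (k : ℕ), windingNumber γ (b j * q ^ k) = 1
  winding_outer : ∀ (j : Fin 3) (k : ℕ), windingNumber γ ((a j)⁻¹ * (q ^ k)⁻¹) = 0

/-! The integral is expanded into residues, the residue series are summed by a rigidity property of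
theta functions, and the genericity needed along the way is removed by continuity.

Residues. Cutting every infinite product after `N` factors makes the integrand rational, with inner
poles at 0 and at b_j q^k for k < N. For such functions the residue theorem along an arbitrary
piecewise C¹ path is partial fractions plus the definition of the winding number
(`contourIntegral_rational`). By the balancing condition the residue at 0 is q^N, which tends to 0.
Dominated convergence, in the integral and in the residue sums, shows that the integral times (q)_∞
∏ (a_i b_j)_∞ is a sum of three balanced ₃φ₂ series (`contourIntegral_eq_totalPoleSum`). The passage
through rational functions replaces any estimate of the integrand on small circles around the
essential singularity 0.

Summation. Fix κ = a₁a₂ and regard the sum as a function S of x = a₁. A telescoping contiguous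
relation (`phi32_contiguous`) relates S(qx) to S(x) up to an error proportional to an elliptic
partial fraction sum, which is zero (`qTheta_partialFraction`). Hence S(qx) = κ/(q x²) S(x). The
proposed right side obeys the same equation. A holomorphic function on the punctured plane with this
behaviour is a theta function of degree two and vanishes as soon as it has two independent zeros
(`eq_zero_of_q_mul_eq_of_zeros`). The difference of the two sides vanishes at x = 1/b₁ and x = 1/b₂:
there two of the three series disappear, the third reduces to 1, and what remains is Weierstrass'
three-term relation (`qTheta_weierstrass`). That relation and the partial fraction identity follow
from the same rigidity principle.

Genericity. The argument needs b_i/b_j and some other ratios to avoid the powers of q. With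
denominators cleared both sides are continuous along a curve in the (b, λ)-space that preserves the
balancing conditions and meets the bad set in countably many parameter values; near the given point
the contour stays separating. -/

open Filter Topology

/-! ### q-shifted factorials, finite and infinite -/

/-- The finite `q`-shifted factorial `(a)_n = ∏_{j < n} (1 - a q^j)`. -/
noncomputable def qPoch (q a : ℂ) (n : ℕ) : ℂ := ∏ j ∈ Finset.range n, (1 - a * q ^ j)

theorem qPoch_zero (q a : ℂ) : qPoch q a 0 = 1 := by simp [qPoch]

theorem qPoch_succ (q a : ℂ) (n : ℕ) : qPoch q a (n + 1) = qPoch q a n * (1 - a * q ^ n) := by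
  simp [qPoch, Finset.prod_range_succ]

theorem qPoch_succ' (q a : ℂ) (n : ℕ) : qPoch q a (n + 1) = (1 - a) * qPoch q (a * q) n := by
  simp only [qPoch, Finset.prod_range_succ', pow_zero, mul_one, mul_comm (1 - a)]
  congr 1
  exact Finset.prod_congr rfl fun j _ => by ring

theorem qPoch_add (q a : ℂ) (m n : ℕ) :
    qPoch q a (m + n) = qPoch q a m * qPoch q (a * q ^ m) n := by
  simp only [qPoch, Finset.prod_range_add]
  congr 1
  exact Finset.prod_congr rfl fun j _ => by ring

theorem differentiable_qPoch (q : ℂ) (n : ℕ) : Differentiable ℂ fun a => qPoch q a n := by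
  unfold qPoch; fun_prop

theorem qPoch_one_eq_zero (q : ℂ) {n : ℕ} (hn : n ≠ 0) : qPoch q 1 n = 0 :=
  Finset.prod_eq_zero (Finset.mem_range.2 (Nat.pos_of_ne_zero hn)) (by simp)

section

variable {q : ℂ} (hq : ‖q‖ < 1)
include hq

theorem summable_norm_mul_pow (a : ℂ) : Summable fun j : ℕ => ‖-(a * q ^ j)‖ := by
  simp only [norm_neg, norm_mul, norm_pow]
  exact (summable_geometric_of_lt_one (norm_nonneg _) hq).mul_left _

theorem qPoch_tendsto (a : ℂ) : Tendsto (qPoch q a) atTop (𝓝 (qPochInf q a)) := by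
  have h := (multipliable_one_add_of_summable (summable_norm_mul_pow hq a)).hasProd.tendsto_prod_nat
  simpa [qPochInf, qPoch, sub_eq_add_neg, funext_iff] using! h

theorem qPochInf_eq_mul (a : ℂ) (n : ℕ) :
    qPochInf q a = qPoch q a n * qPochInf q (a * q ^ n) := by
  refine tendsto_nhds_unique ((tendsto_add_atTop_iff_nat n).2 (qPoch_tendsto hq a)) ?_
  refine ((qPoch_tendsto hq (a * q ^ n)).const_mul (qPoch q a n)).congr fun m => ?_
  rw [add_comm, qPoch_add]

theorem qPochInf_eq_one_sub_mul (a : ℂ) : qPochInf q a = (1 - a) * qPochInf q (a * q) := by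
  simpa [qPoch] using qPochInf_eq_mul hq a 1

/-- This follows from 1 + x ≤ eˣ and the geometric series. The bound does not depend on `n`, so it
supplies the majorants in all later uses of dominated convergence. -/
theorem norm_qPoch_le (a : ℂ) (n : ℕ) : ‖qPoch q a n‖ ≤ Real.exp (‖a‖ / (1 - ‖q‖)) := by
  rw [qPoch, norm_prod]
  have h1 : ∏ j ∈ Finset.range n, ‖1 - a * q ^ j‖
      ≤ ∏ j ∈ Finset.range n, Real.exp (‖a‖ * ‖q‖ ^ j) := by
    refine Finset.prod_le_prod (fun _ _ => norm_nonneg _) fun j _ => ?_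
    calc ‖1 - a * q ^ j‖ ≤ ‖(1 : ℂ)‖ + ‖a * q ^ j‖ := norm_sub_le _ _
      _ = ‖a‖ * ‖q‖ ^ j + 1 := by simp [add_comm]
      _ ≤ _ := Real.add_one_le_exp _
  refine h1.trans ?_
  rw [← Real.exp_sum, Real.exp_le_exp, ← Finset.mul_sum, div_eq_mul_inv]
  refine mul_le_mul_of_nonneg_left ?_ (norm_nonneg _)
  rw [← tsum_geometric_of_lt_one (norm_nonneg _) hq]
  exact (summable_geometric_of_lt_one (norm_nonneg _) hq).sum_le_tsum _ fun _ _ => by positivity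

theorem norm_qPochInf_le (a : ℂ) : ‖qPochInf q a‖ ≤ Real.exp (‖a‖ / (1 - ‖q‖)) :=
  le_of_tendsto (qPoch_tendsto hq a).norm (Eventually.of_forall (norm_qPoch_le hq a))

theorem qPoch_ne_zero {a : ℂ} (h : qPochInf q a ≠ 0) (n : ℕ) : qPoch q a n ≠ 0 := fun h0 =>
  h (by rw [qPochInf_eq_mul hq a n, h0, zero_mul])

/-- The partial products of a non-vanishing infinite product are bounded away from zero. -/
theorem norm_inv_qPoch_le {a : ℂ} (h : qPochInf q a ≠ 0) (n : ℕ) :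
    ‖(qPoch q a n)⁻¹‖ ≤ Real.exp (‖a‖ / (1 - ‖q‖)) * ‖(qPochInf q a)⁻¹‖ := by
  have h1 := qPochInf_eq_mul hq a n
  have h2 : qPochInf q (a * q ^ n) ≠ 0 := fun h0 => h (by rw [h1, h0, mul_zero])
  have h3 : (qPoch q a n)⁻¹ = qPochInf q (a * q ^ n) * (qPochInf q a)⁻¹ := by
    rw [h1, mul_inv]; field_simp
  rw [h3, norm_mul]
  refine mul_le_mul_of_nonneg_right ((norm_qPochInf_le hq _).trans ?_) (norm_nonneg _)
  rw [Real.exp_le_exp]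
  refine div_le_div_of_nonneg_right ?_ (by linarith)
  rw [norm_mul, norm_pow]
  exact mul_le_of_le_one_right (norm_nonneg _) (pow_le_one₀ (norm_nonneg _) hq.le)

theorem qPochInf_eq_zero_iff (a : ℂ) : qPochInf q a = 0 ↔ ∃ k : ℕ, a * q ^ k = 1 := by
  constructor
  · intro h
    by_contra! h'
    refine tprod_one_add_ne_zero_of_summable (f := fun j : ℕ => -(a * q ^ j)) (fun i => ?_)
      (summable_norm_mul_pow hq a) (by simpa [qPochInf, sub_eq_add_neg] using h)
    rw [← sub_eq_add_neg]
    exact sub_ne_zero.2 (h' i).symm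
  · rintro ⟨k, hk⟩
    rw [qPochInf_eq_mul hq a (k + 1), qPoch_succ, hk]
    simp

theorem qPochInf_self_ne_zero : qPochInf q q ≠ 0 := by
  rw [Ne, qPochInf_eq_zero_iff hq]
  rintro ⟨k, hk⟩
  have : ‖q ^ (k + 1)‖ < 1 := by
    rw [norm_pow]; exact pow_lt_one₀ (norm_nonneg _) hq (by simp)
  rw [pow_succ', hk] at this
  simp at this

theorem qPochInf_one : qPochInf q 1 = 0 := (qPochInf_eq_zero_iff hq 1).2 ⟨0, by simp⟩

theorem differentiable_qPochInf : Differentiable ℂ (qPochInf q) := by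
  have hloc : ∀ r : ℝ, DifferentiableOn ℂ (qPochInf q) (Metric.ball 0 r) := by
    intro r
    have hs : Summable fun j : ℕ => r * ‖q‖ ^ j :=
      (summable_geometric_of_lt_one (norm_nonneg _) hq).mul_left _
    have h := Summable.hasProdLocallyUniformlyOn_nat_one_add (f := fun j a => -(a * q ^ j))
      (K := Metric.ball (0 : ℂ) r) Metric.isOpen_ball hs
      (Eventually.of_forall fun n x hx => by
        rw [norm_neg, norm_mul, norm_pow]
        exact mul_le_mul_of_nonneg_right (mem_ball_zero_iff.1 hx).le (by positivity))
      (fun n => by fun_prop)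
    have h2 := h.tendstoLocallyUniformlyOn_finsetRange.differentiableOn
      (Eventually.of_forall fun n => by fun_prop) Metric.isOpen_ball
    refine h2.congr fun x _ => ?_
    simp [qPochInf, sub_eq_add_neg]
  intro z
  exact (hloc (‖z‖ + 1)).differentiableAt (Metric.isOpen_ball.mem_nhds (by simp))

theorem continuous_qPochInf : Continuous (qPochInf q) := (differentiable_qPochInf hq).continuous

end

/-! ### The theta function: functional equations and simple zeros -/

section

variable {q : ℂ} (hq : ‖q‖ < 1) (hq0 : q ≠ 0)
include hq hq0

theorem qTheta_q_mul {x : ℂ} (hx : x ≠ 0) : qTheta q (q * x) = -(qTheta q x / x) := by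
  have h1 : q / (q * x) = 1 / x := by field_simp
  have h2 : 1 / x * q = q / x := by ring
  rw [qTheta, qTheta, h1, qPochInf_eq_one_sub_mul hq (1 / x), h2, qPochInf_eq_one_sub_mul hq x,
    mul_comm x q]
  field_simp
  ring

theorem qTheta_inv {x : ℂ} (hx : x ≠ 0) : qTheta q x⁻¹ = -(qTheta q x / x) := by
  rw [← qTheta_q_mul hq hq0 hx, qTheta, qTheta, mul_comm]
  congr 2 <;> field_simp

omit hq in
theorem qTheta_q_div {x : ℂ} (hx : x ≠ 0) : qTheta q (q / x) = qTheta q x := by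
  rw [qTheta, qTheta, mul_comm]; congr 2; field_simp

theorem qTheta_div_q {x : ℂ} (hx : x ≠ 0) : qTheta q (x / q) = -(x / q * qTheta q x) := by
  have h := qTheta_q_mul hq hq0 (div_ne_zero hx hq0)
  rw [mul_div_cancel₀ _ hq0] at h
  rw [h]; field_simp

theorem qTheta_eq_zero_iff {x : ℂ} (hx : x ≠ 0) : qTheta q x = 0 ↔ ∃ k : ℤ, x = q ^ k := by
  rw [qTheta, mul_eq_zero, qPochInf_eq_zero_iff hq, qPochInf_eq_zero_iff hq]
  constructor
  · rintro (⟨k, hk⟩ | ⟨k, hk⟩)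
    · exact ⟨-k, by rw [zpow_neg, zpow_natCast]; exact eq_inv_of_mul_eq_one_left hk⟩
    · refine ⟨k + 1, ?_⟩
      rw [zpow_add_one₀ hq0, zpow_natCast]
      field_simp at hk
      rw [← hk]; ring
  · rintro ⟨k, rfl⟩
    rcases le_or_gt k 0 with h | h
    · left
      refine ⟨k.natAbs, ?_⟩
      rw [← zpow_natCast, ← zpow_add₀ hq0]
      have : k + (k.natAbs : ℤ) = 0 := by lia
      rw [this, zpow_zero]
    · right
      refine ⟨(k - 1).natAbs, ?_⟩
      rw [← zpow_natCast, div_mul_eq_mul_div, ← zpow_one_add₀ hq0]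
      have : 1 + ((k - 1).natAbs : ℤ) = k := by lia
      rw [this, div_self (zpow_ne_zero _ hq0)]

omit hq0 in
theorem differentiableAt_qTheta {x : ℂ} (hx : x ≠ 0) : DifferentiableAt ℂ (qTheta q) x := by
  have h := differentiable_qPochInf hq
  unfold qTheta
  refine (h x).mul ((h _).comp x ?_)
  exact (differentiableAt_const q).div differentiableAt_id hx

omit hq0 in
theorem qTheta_one : qTheta q 1 = 0 := by
  rw [qTheta, qPochInf_one hq, zero_mul]

/-- At x = 1 the factor 1 - x is explicit and its cofactor equals (q)_∞² ≠ 0. Differentiating θ(qx)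
= -θ(x)/x at a zero carries simplicity along q^ℤ in both directions. -/
theorem deriv_qTheta_ne_zero {x : ℂ} (hx : x ≠ 0) (h0 : qTheta q x = 0) :
    deriv (qTheta q) x ≠ 0 := by
  have key : ∀ y : ℂ, y ≠ 0 → qTheta q y = 0 →
      q * deriv (qTheta q) (q * y) = -(deriv (qTheta q) y / y) := by
    intro y hy hy0
    have hqy : HasDerivAt (qTheta q) (deriv (qTheta q) (q * y)) (q * y) :=
      (differentiableAt_qTheta hq (mul_ne_zero hq0 hy)).hasDerivAt
    have e1 : HasDerivAt (fun y => qTheta q (q * y)) (deriv (qTheta q) (q * y) * q) y := by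
      have := hqy.comp y ((hasDerivAt_id y).const_mul q)
      simpa [Function.comp_def] using this
    have e2 := ((differentiableAt_qTheta hq hy).hasDerivAt.div (hasDerivAt_id y) hy).neg
    have e3 : (fun y => qTheta q (q * y)) =ᶠ[𝓝 y] -(qTheta q / id) := by
      filter_upwards [isOpen_ne.mem_nhds hy] with z hz
      exact qTheta_q_mul hq hq0 hz
    have := e1.unique (e2.congr_of_eventuallyEq e3)
    rw [mul_comm, this, hy0]
    simp only [id]
    field_simp
    ring_nf
  have base : deriv (qTheta q) 1 ≠ 0 := by
    have hq2 := qPochInf_self_ne_zero hq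
    have e : qTheta q = fun x => (1 - x) * (qPochInf q (x * q) * qPochInf q (q / x)) := by
      ext x; rw [qTheta, qPochInf_eq_one_sub_mul hq x]; ring
    have d : DifferentiableAt ℂ (fun x => qPochInf q (x * q) * qPochInf q (q / x)) 1 := by
      have h := differentiable_qPochInf hq
      refine ((h _).comp (1 : ℂ) (by fun_prop)).mul ((h _).comp (1 : ℂ) ?_)
      exact (differentiableAt_const q).div differentiableAt_id one_ne_zero
    have h1 := ((hasDerivAt_id (1 : ℂ)).const_sub 1).mul d.hasDerivAt
    have h2 : HasDerivAt (qTheta q) (-(qPochInf q q * qPochInf q q)) 1 := by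
      rw [e]
      exact HasDerivAt.congr_deriv h1 (by simp)
    rw [h2.deriv]
    simp [hq2]
  obtain ⟨k, rfl⟩ := (qTheta_eq_zero_iff hq hq0 hx).1 h0
  have hz : ∀ k : ℤ, qTheta q (q ^ k) = 0 := fun k =>
    (qTheta_eq_zero_iff hq hq0 (zpow_ne_zero _ hq0)).2 ⟨k, rfl⟩
  have step : ∀ k : ℤ, q * deriv (qTheta q) (q ^ (k + 1)) = -(deriv (qTheta q) (q ^ k) / q ^ k) := by
    intro k
    rw [← key _ (zpow_ne_zero k hq0) (hz k), zpow_add_one₀ hq0, mul_comm q (q ^ k)]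
  induction k using Int.induction_on with
  | zero => simpa using base
  | succ k ih =>
    intro h
    have := step k
    rw [h, mul_zero, eq_comm, neg_eq_zero, div_eq_zero_iff] at this
    exact this.elim (ih (zpow_ne_zero _ hq0) (hz _)) (zpow_ne_zero _ hq0)
  | pred k ih =>
    intro h
    have := step (-k - 1)
    rw [h, zero_div, neg_zero, sub_add_cancel] at this
    exact (mul_ne_zero hq0 (ih (zpow_ne_zero _ hq0) (hz _))) this

end

/-! ### Rigidity of functions quasi-periodic under x ↦ qx -/

/-- A holomorphic function is divisible by one with only simple zeros, at which it vanishes. -/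
theorem exists_differentiableOn_eq_mul {U : Set ℂ} (hU : IsOpen U) {f g : ℂ → ℂ}
    (hf : DifferentiableOn ℂ f U) (hg : DifferentiableOn ℂ g U)
    (hg' : ∀ z ∈ U, g z = 0 → deriv g z ≠ 0) (hfg : ∀ z ∈ U, g z = 0 → f z = 0) :
    ∃ h : ℂ → ℂ, DifferentiableOn ℂ h U ∧ ∀ z ∈ U, f z = g z * h z := by
  classical
  refine ⟨fun z => if g z = 0 then deriv f z / deriv g z else f z / g z, ?_, ?_⟩
  · intro z hz
    refine DifferentiableAt.differentiableWithinAt ?_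
    have hUz := hU.mem_nhds hz
    by_cases h0 : g z = 0
    -- Near a zero of `g` the quotient f/g equals the quotient of the two difference slopes, whose
    -- denominator does not vanish there.
    · have hF := ((Complex.differentiableOn_dslope hUz).2 hf).differentiableAt hUz
      have hG := ((Complex.differentiableOn_dslope hUz).2 hg).differentiableAt hUz
      have hG0 : dslope g z z ≠ 0 := by rw [dslope_same]; exact hg' z hz h0
      refine (hF.div hG hG0).congr_of_eventuallyEq ?_
      filter_upwards [hG.continuousAt.eventually_ne hG0] with w hw
      rcases eq_or_ne w z with rfl | hwz
      · simp [h0, dslope_same]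
      · have e1 := sub_smul_dslope f z w
        have e2 := sub_smul_dslope g z w
        rw [hfg z hz h0, sub_zero, smul_eq_mul] at e1
        rw [h0, sub_zero, smul_eq_mul] at e2
        have hs := sub_ne_zero.2 hwz
        rw [← e1, ← e2, if_neg (mul_ne_zero hs hw), mul_div_mul_left _ _ hs]
        rfl
    · refine ((hf.differentiableAt hUz).div (hg.differentiableAt hUz) h0).congr_of_eventuallyEq ?_
      filter_upwards [(hg.differentiableAt hUz).continuousAt.eventually_ne h0] with w hw
      simp [hw]
  · intro z hz
    by_cases h0 : g z = 0
    · simp [h0, hfg z hz h0]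
    · simp only [h0, if_false]; field_simp

/-- A countable set has dense complement in ℂ. This discards the exceptional points where a
derivation divides by zero. -/
theorem eqOn_of_eqOn_diff_countable {U S : Set ℂ} (hU : IsOpen U) (hS : S.Countable)
    {f g : ℂ → ℂ} (hf : ContinuousOn f U) (hg : ContinuousOn g U)
    (h : ∀ z ∈ U, z ∉ S → f z = g z) : ∀ z ∈ U, f z = g z := by
  intro z hz
  have hne : (𝓝[Sᶜ] z).NeBot := mem_closure_iff_nhdsWithin_neBot.1 (hS.dense_compl ℝ z)
  have h1 := ((hf.continuousAt (hU.mem_nhds hz)).tendsto).mono_left (nhdsWithin_le_nhds (s := Sᶜ))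
  have h2 := ((hg.continuousAt (hU.mem_nhds hz)).tendsto).mono_left (nhdsWithin_le_nhds (s := Sᶜ))
  refine tendsto_nhds_unique (h1.congr' ?_) h2
  filter_upwards [self_mem_nhdsWithin, nhdsWithin_le_nhds (hU.mem_nhds hz)] with w hw hw'
  exact h w hw' hw

theorem countable_zpow_mul (q c : ℂ) : {z : ℂ | ∃ k : ℤ, z = c * q ^ k}.Countable :=
  (Set.countable_range fun k : ℤ => c * q ^ k).mono <| by
    rintro _ ⟨k, hk⟩
    exact ⟨k, hk.symm⟩

section

variable {q : ℂ} (hq : ‖q‖ < 1) (hq0 : q ≠ 0)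
include hq hq0

/-- A holomorphic function on the punctured plane with `k(qx) = C k(x)` vanishes unless `C` is a
power of `q`. -/
theorem eq_zero_of_q_mul_eq_const_mul {k : ℂ → ℂ} (hk : DifferentiableOn ℂ k {0}ᶜ) {C : ℂ}
    (hC0 : C ≠ 0) (hC : ∀ n : ℤ, C ≠ q ^ n) (hkq : ∀ x ≠ 0, k (q * x) = C * k x) :
    ∀ x ≠ 0, k x = 0 := by
  have hqn : 0 < ‖q‖ := norm_pos_iff.2 hq0
  -- Multiplying by x^m turns the multiplier into C q^m. Once its modulus is at most 1, a bound on
  -- the annulus |q| ≤ |y| ≤ 1 propagates to the whole punctured disc, so the singularity at 0 is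
  -- removable.
  obtain ⟨m, hm⟩ : ∃ m : ℕ, ‖C * q ^ m‖ ≤ 1 := by
    have h : Tendsto (fun m : ℕ => ‖C * q ^ m‖) atTop (𝓝 0) := by
      simpa [norm_mul, norm_pow] using
        (tendsto_pow_atTop_nhds_zero_of_lt_one hqn.le hq).const_mul ‖C‖
    exact ((h.eventually_lt_const one_pos).exists).imp fun _ h => h.le
  set C' := C * q ^ m with hC'
  have hC'0 : C' ≠ 0 := mul_ne_zero hC0 (pow_ne_zero _ hq0)
  set g : ℂ → ℂ := fun x => x ^ m * k x with hg
  have hgd : DifferentiableOn ℂ g {0}ᶜ := (differentiable_pow m).differentiableOn.mul hk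
  have hgq : ∀ x ≠ 0, g (q * x) = C' * g x := by
    intro x hx
    simp only [hg, hC', hkq x hx]; ring
  have hgqn : ∀ (n : ℕ) (x : ℂ), x ≠ 0 → g (q ^ n * x) = C' ^ n * g x := by
    intro n
    induction n with
    | zero => simp
    | succ n ih =>
      intro x hx
      rw [pow_succ', mul_assoc, hgq _ (mul_ne_zero (pow_ne_zero _ hq0) hx), ih x hx]; ring
  suffices hg0 : ∀ x ≠ 0, g x = 0 from fun x hx =>
    (mul_eq_zero.1 (hg0 x hx)).resolve_left (pow_ne_zero _ hx)
  obtain ⟨M, hM⟩ : ∃ M, ∀ y : ℂ, ‖q‖ ≤ ‖y‖ → ‖y‖ ≤ 1 → ‖g y‖ ≤ M := by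
    have hK : IsCompact (Metric.closedBall (0 : ℂ) 1 ∩ {y | ‖q‖ ≤ ‖y‖}) :=
      (isCompact_closedBall _ _).inter_right (isClosed_le continuous_const continuous_norm)
    obtain ⟨M, hM⟩ := hK.exists_bound_of_continuousOn (hgd.continuousOn.mono fun y hy => by
      have : 0 < ‖y‖ := hqn.trans_le hy.2
      exact norm_pos_iff.1 this)
    exact ⟨M, fun y h1 h2 => hM y ⟨mem_closedBall_zero_iff.2 h2, h1⟩⟩
  have hb : ∀ x : ℂ, x ≠ 0 → ‖x‖ ≤ 1 → ‖g x‖ ≤ M := by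
    intro x hx hx1
    obtain ⟨n, hn1, hn2⟩ := exists_nat_pow_near_of_lt_one (norm_pos_iff.2 hx) hx1 hqn hq
    have hqn0 : q ^ n ≠ 0 := pow_ne_zero _ hq0
    have hqp : 0 < ‖q‖ ^ n := by positivity
    have e : x = q ^ n * (x / q ^ n) := by field_simp
    rw [e, hgqn n _ (div_ne_zero hx hqn0), norm_mul, norm_pow]
    have hy : ‖g (x / q ^ n)‖ ≤ M := by
      apply hM
      · rw [norm_div, norm_pow, le_div_iff₀ hqp, ← pow_succ']; exact hn1.le
      · rw [norm_div, norm_pow, div_le_one hqp]; exact hn2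
    calc _ ≤ 1 * ‖g (x / q ^ n)‖ :=
          mul_le_mul_of_nonneg_right (pow_le_one₀ (norm_nonneg _) hm) (norm_nonneg _)
      _ ≤ M := by rwa [one_mul]
  have hG := Complex.differentiableOn_update_limUnder_of_bddAbove
    (Metric.ball_mem_nhds (0 : ℂ) one_pos) (f := g)
    (hgd.mono fun x hx => hx.2) ⟨M, by
      rintro _ ⟨x, hx, rfl⟩
      exact hb x hx.2 (mem_ball_zero_iff.1 hx.1).le⟩
  set G := Function.update g 0 (limUnder (𝓝[≠] (0 : ℂ)) g) with hGdef
  have hGg : ∀ x ≠ 0, G x = g x := fun x hx => by simp [hGdef, hx]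
  have hGan : AnalyticAt ℂ G 0 := hG.analyticAt (Metric.ball_mem_nhds _ one_pos)
  have hqt : Tendsto (fun z : ℂ => q * z) (𝓝 0) (𝓝 0) := by
    simpa using (continuous_const_mul q).tendsto (0 : ℂ)
  by_cases hev : ∀ᶠ z in 𝓝 (0 : ℂ), G z = 0
  · intro x hx
    have ht : Tendsto (fun n : ℕ => q ^ n * x) atTop (𝓝 0) := by
      simpa using (tendsto_pow_atTop_nhds_zero_of_norm_lt_one hq).mul_const x
    obtain ⟨n, hn⟩ := (ht.eventually hev).exists
    rw [hGg _ (mul_ne_zero (pow_ne_zero _ hq0) hx), hgqn n x hx] at hn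
    exact (mul_eq_zero.1 hn).resolve_left (pow_ne_zero _ hC'0)
  · exfalso
    -- Comparing lowest-order coefficients at 0 forces the multiplier to be qⁿ with n the order of
    -- vanishing, contrary to `hC`.
    obtain ⟨n, h, hh, hh0, hGh⟩ := hGan.exists_eventuallyEq_pow_smul_nonzero_iff.2 hev
    have h1 : Tendsto (fun z => q ^ n * h (q * z)) (𝓝[≠] 0) (𝓝 (q ^ n * h 0)) :=
      ((hh.continuousAt.tendsto.comp hqt).const_mul _).mono_left nhdsWithin_le_nhds
    have h2 : Tendsto (fun z => C' * h z) (𝓝[≠] 0) (𝓝 (C' * h 0)) :=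
      (hh.continuousAt.tendsto.const_mul _).mono_left nhdsWithin_le_nhds
    have h3 : (fun z => q ^ n * h (q * z)) =ᶠ[𝓝[≠] 0] fun z => C' * h z := by
      filter_upwards [nhdsWithin_le_nhds hGh, nhdsWithin_le_nhds (hqt.eventually hGh),
        self_mem_nhdsWithin] with z hz1 hz2 hz0
      have hz0' : z ≠ 0 := hz0
      have hzn : z ^ n ≠ 0 := pow_ne_zero _ hz0'
      rw [hGg _ hz0'] at hz1
      rw [hGg _ (mul_ne_zero hq0 hz0'), hgq z hz0', hz1] at hz2
      simp only [sub_zero, smul_eq_mul, mul_pow] at hz2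
      apply mul_left_cancel₀ hzn
      linear_combination -hz2
    have h4 := tendsto_nhds_unique (h1.congr' h3) h2
    have h5 : C' = q ^ n := (mul_right_cancel₀ hh0 h4).symm
    refine hC ((n : ℤ) - m) ?_
    rw [zpow_sub₀ hq0, zpow_natCast, zpow_natCast, ← h5, hC']
    field_simp

/-- The functional equation spreads the zero `u` over u q^ℤ, which is exactly the zero set of
θ(x/u), and those zeros are simple. Each such division raises the exponent of x in the functional
equation by one. -/
theorem exists_eq_qTheta_mul {f : ℂ → ℂ} (hf : DifferentiableOn ℂ f {0}ᶜ) {C u : ℂ} {e : ℤ}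
    (hC : C ≠ 0) (hfq : ∀ x ≠ 0, f (q * x) = C * x ^ e * f x) (hu : u ≠ 0) (hfu : f u = 0) :
    ∃ h : ℂ → ℂ, DifferentiableOn ℂ h {0}ᶜ ∧ (∀ x ≠ 0, f x = qTheta q (x / u) * h x) ∧
      ∀ x ≠ 0, h (q * x) = -(C / u) * x ^ (e + 1) * h x := by
  have hf0 : ∀ k : ℤ, f (q ^ k * u) = 0 := by
    intro k
    have hk0 : ∀ k : ℤ, q ^ k * u ≠ 0 := fun k => mul_ne_zero (zpow_ne_zero _ hq0) hu
    induction k using Int.induction_on with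
    | zero => simpa using hfu
    | succ k ih =>
      rw [zpow_add_one₀ hq0, mul_comm (q ^ _) q, mul_assoc, hfq _ (hk0 _), ih, mul_zero]
    | pred k ih =>
      have h := hfq _ (hk0 (-k - 1))
      rw [← mul_assoc, ← zpow_one_add₀ hq0, add_sub_cancel, ih, eq_comm, mul_eq_zero] at h
      exact h.resolve_left (mul_ne_zero hC (zpow_ne_zero _ (hk0 _)))
  have hg : ∀ x : ℂ, x ≠ 0 → HasDerivAt (fun x => qTheta q (x / u))
      (deriv (qTheta q) (x / u) * (1 / u)) x := fun x hx =>
    HasDerivAt.comp (h₂ := qTheta q) (h := fun x => x / u) x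
      (differentiableAt_qTheta hq (div_ne_zero hx hu)).hasDerivAt ((hasDerivAt_id x).div_const u)
  obtain ⟨h, hd, hh⟩ := exists_differentiableOn_eq_mul isOpen_compl_singleton hf
    (g := fun x => qTheta q (x / u))
    (fun x hx => (hg x hx).differentiableAt.differentiableWithinAt)
    (fun x hx h0 => by
      rw [(hg x hx).deriv]
      exact mul_ne_zero (deriv_qTheta_ne_zero hq hq0 (div_ne_zero hx hu) h0)
        (one_div_ne_zero hu))
    (fun x hx h0 => by
      obtain ⟨k, hk⟩ := (qTheta_eq_zero_iff hq hq0 (div_ne_zero hx hu)).1 h0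
      rw [div_eq_iff hu] at hk
      rw [hk, hf0])
  refine ⟨h, hd, hh, ?_⟩
  refine eqOn_of_eqOn_diff_countable isOpen_compl_singleton (countable_zpow_mul q u) ?_ ?_ ?_
  · exact hd.continuousOn.comp (by fun_prop) fun x hx => mul_ne_zero hq0 hx
  · refine ContinuousOn.mul (ContinuousOn.mul continuousOn_const ?_) hd.continuousOn
    exact continuousOn_id.zpow₀ _ fun x hx => Or.inl hx
  · intro x hx hxS
    have hx : x ≠ 0 := hx
    have hθ : qTheta q (x / u) ≠ 0 := by
      rw [Ne, qTheta_eq_zero_iff hq hq0 (div_ne_zero hx hu)]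
      rintro ⟨k, hk⟩
      rw [div_eq_iff hu, mul_comm] at hk
      exact hxS ⟨k, hk⟩
    have e1 := hh _ (mul_ne_zero hq0 hx)
    rw [hfq x hx, hh x hx, mul_div_assoc, qTheta_q_mul hq hq0 (div_ne_zero hx hu)] at e1
    have e2 : C * x ^ e * h x = -(h (q * x) / (x / u)) := by
      apply mul_left_cancel₀ hθ
      linear_combination e1
    rw [zpow_add_one₀ hx]
    field_simp at e2
    field_simp
    linear_combination e2

/-- A theta function of degree two with two independent zeros vanishes. -/
theorem eq_zero_of_q_mul_eq_of_zeros {f : ℂ → ℂ} (hf : DifferentiableOn ℂ f {0}ᶜ) {C u v : ℂ}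
    (hC : C ≠ 0) (hfq : ∀ x ≠ 0, f (q * x) = C / x ^ 2 * f x) (hu : u ≠ 0) (hv : v ≠ 0)
    (hfu : f u = 0) (hfv : f v = 0) (huv : ∀ k : ℤ, v / u ≠ q ^ k)
    (hCuv : ∀ k : ℤ, C / (u * v) ≠ q ^ k) : ∀ x ≠ 0, f x = 0 := by
  -- Dividing out both zeros brings the exponent from -2 to 0 and leaves the constant multiplier
  -- C/(uv).
  obtain ⟨g, hg, hfg, hgq⟩ := exists_eq_qTheta_mul hq hq0 hf (e := -2) hC
    (fun x hx => by rw [hfq x hx]; rfl) hu hfu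
  have hgv : g v = 0 := by
    rw [hfg v hv, mul_eq_zero, qTheta_eq_zero_iff hq hq0 (div_ne_zero hv hu)] at hfv
    exact hfv.resolve_left fun ⟨k, hk⟩ => huv k hk
  obtain ⟨k, hk, hgk, hkq⟩ := exists_eq_qTheta_mul hq hq0 hg
    (neg_ne_zero.2 (div_ne_zero hC hu)) hgq hv hgv
  have h0 := eq_zero_of_q_mul_eq_const_mul hq hq0 hk (C := C / (u * v))
    (div_ne_zero hC (mul_ne_zero hu hv)) hCuv fun x hx => by
      rw [hkq x hx]
      norm_num
      field_simp
  intro x hx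
  rw [hfg x hx, hgk x hx, h0 x hx, mul_zero, mul_zero]

end

/-! ### Weierstrass' relation and elliptic partial fractions -/

section

variable {q : ℂ} (hq : ‖q‖ < 1)
include hq

theorem differentiableOn_qTheta_mul {c : ℂ} (hc : c ≠ 0) :
    DifferentiableOn ℂ (fun x => qTheta q (x * c)) {0}ᶜ := fun x hx =>
  (DifferentiableAt.comp (g := qTheta q) (f := fun x => x * c) x
    (differentiableAt_qTheta hq (mul_ne_zero hx hc)) (by fun_prop)).differentiableWithinAt

theorem differentiableOn_qTheta_div {c : ℂ} (hc : c ≠ 0) :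
    DifferentiableOn ℂ (fun x => qTheta q (x / c)) {0}ᶜ := by
  simpa only [div_eq_mul_inv] using differentiableOn_qTheta_mul hq (inv_ne_zero hc)

theorem differentiableOn_qTheta_const_div {c : ℂ} (hc : c ≠ 0) :
    DifferentiableOn ℂ (fun x => qTheta q (c / x)) {0}ᶜ := fun x hx =>
  (DifferentiableAt.comp (g := qTheta q) (f := fun x => c / x) x
    (differentiableAt_qTheta hq (div_ne_zero hc hx))
    ((differentiableAt_const c).div differentiableAt_id hx)).differentiableWithinAt

variable (hq0 : q ≠ 0)
include hq0

theorem qTheta_ne_zero {x : ℂ} (hx : x ≠ 0) (h : ∀ k : ℤ, x ≠ q ^ k) : qTheta q x ≠ 0 := by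
  rw [Ne, qTheta_eq_zero_iff hq hq0 hx]
  rintro ⟨k, hk⟩
  exact h k hk

theorem qTheta_q_mul_mul {x c : ℂ} (hx : x ≠ 0) (hc : c ≠ 0) :
    qTheta q (q * x * c) = -(1 / (x * c)) * qTheta q (x * c) := by
  rw [mul_assoc, qTheta_q_mul hq hq0 (mul_ne_zero hx hc)]; ring

theorem qTheta_q_mul_div {x c : ℂ} (hx : x ≠ 0) (hc : c ≠ 0) :
    qTheta q (q * x / c) = -(c / x) * qTheta q (x / c) := by
  rw [mul_div_assoc, qTheta_q_mul hq hq0 (div_ne_zero hx hc)]; field_simp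

theorem qTheta_div_q_mul {x c : ℂ} (hx : x ≠ 0) (hc : c ≠ 0) :
    qTheta q (c / (q * x)) = -(c / (x * q)) * qTheta q (c / x) := by
  rw [mul_comm q x, ← div_div, qTheta_div_q hq hq0 (div_ne_zero hc hx)]; field_simp

/-- Weierstrass' three-term relation. -/
theorem qTheta_weierstrass {x y a₂ a₃ b₂ b₃ : ℂ} (hx : x ≠ 0) (hy : y ≠ 0) (ha₂ : a₂ ≠ 0)
    (ha₃ : a₃ ≠ 0) (hb₂ : b₂ ≠ 0) (hb₃ : b₃ ≠ 0) (hbal : a₂ * a₃ * b₂ * b₃ = q)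
    (h₂ : ∀ k : ℤ, a₂ / y ≠ q ^ k) (h₃ : ∀ k : ℤ, a₃ / y ≠ q ^ k) :
    qTheta q (x / a₂) * qTheta q (x / a₃) * qTheta q (y * b₂) * qTheta q (y * b₃)
        - x / y * qTheta q (x * b₂) * qTheta q (x * b₃) * qTheta q (y / a₂) * qTheta q (y / a₃)
      = qTheta q (x / y) * qTheta q (x * y / (a₂ * a₃)) * qTheta q (a₂ * b₂) *
        qTheta q (a₂ * b₃) := by
  set c : ℂ := y / (a₂ * a₃) with hc
  have hc0 : c ≠ 0 := by positivity
  -- All three terms are theta functions of degree two in x with multiplier a₂a₃/x². At x = y and at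
  -- x = a₂ one term contains θ(1) = 0 and the other two cancel.
  have key := eq_zero_of_q_mul_eq_of_zeros hq hq0 (C := a₂ * a₃) (u := y) (v := a₂)
    (f := fun x =>
      qTheta q (x / a₂) * qTheta q (x / a₃) * (qTheta q (y * b₂) * qTheta q (y * b₃))
        - x / y * (qTheta q (x * b₂) * qTheta q (x * b₃)) * (qTheta q (y / a₂) * qTheta q (y / a₃))
      - qTheta q (x / y) * qTheta q (x * c) * (qTheta q (a₂ * b₂) * qTheta q (a₂ * b₃)))
    ?_ (mul_ne_zero ha₂ ha₃) ?_ hy ha₂ ?_ ?_ h₂ ?_ x hx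
  · have e : x * y / (a₂ * a₃) = x * c := by rw [hc]; ring
    rw [e]
    linear_combination key
  · have d := @differentiableOn_qTheta_mul q hq
    have d' := @differentiableOn_qTheta_div q hq
    exact ((((d' ha₂).mul (d' ha₃)).mul_const _).sub ((((differentiableOn_id).div_const y).mul
      ((d hb₂).mul (d hb₃))).mul_const _)).sub (((d' hy).mul (d hc0)).mul_const _)
  · intro x hx
    have t1 : qTheta q (q * x / a₂) * qTheta q (q * x / a₃) =
        a₂ * a₃ / x ^ 2 * (qTheta q (x / a₂) * qTheta q (x / a₃)) := by
      rw [qTheta_q_mul_div hq hq0 hx ha₂, qTheta_q_mul_div hq hq0 hx ha₃]; field_simp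
    have t2 : q * x / y * (qTheta q (q * x * b₂) * qTheta q (q * x * b₃)) =
        a₂ * a₃ / x ^ 2 * (x / y * (qTheta q (x * b₂) * qTheta q (x * b₃))) := by
      rw [qTheta_q_mul_mul hq hq0 hx hb₂, qTheta_q_mul_mul hq hq0 hx hb₃]
      generalize qTheta q (x * b₂) = A
      generalize qTheta q (x * b₃) = B
      rw [← hbal]; field_simp
    have t3 : qTheta q (q * x / y) * qTheta q (q * x * c) =
        a₂ * a₃ / x ^ 2 * (qTheta q (x / y) * qTheta q (x * c)) := by
      rw [qTheta_q_mul_div hq hq0 hx hy, qTheta_q_mul_mul hq hq0 hx hc0]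
      generalize qTheta q (x * c) = A
      rw [hc]; field_simp
    simp only [t1, t2, t3]
    ring
  · simp only [div_self hy, qTheta_one hq]
    rw [hc]
    ring
  · have e1 : qTheta q (a₂ / y) = -(a₂ / y) * qTheta q (y / a₂) := by
      rw [← inv_div, qTheta_inv hq hq0 (div_ne_zero hy ha₂)]; field_simp
    have e2 : a₂ * c = y / a₃ := by rw [hc]; field_simp
    simp only [div_self ha₂, qTheta_one hq, e1, e2]
    ring
  · intro k hk
    refine h₃ k ?_
    rw [← hk]; field_simp

/-- This is the partial fraction sum at l₁ = 1/b₁, where the first term drops out. The balancing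
condition and reflection exchange θ(M b₁ b₂) for θ(l b₃), and likewise with 2 and 3 swapped, so the
two terms cancel. -/
theorem qTheta_partialFraction_aux {b₁ b₂ b₃ l M : ℂ} (hb₁ : b₁ ≠ 0) (hb₂ : b₂ ≠ 0)
    (hb₃ : b₃ ≠ 0) (hl : l ≠ 0) (hbal : M * l * b₁ * b₂ * b₃ = q ^ 2)
    (h₁₂ : ∀ k : ℤ, b₁ / b₂ ≠ q ^ k) (h₁₃ : ∀ k : ℤ, b₁ / b₃ ≠ q ^ k)
    (h₂₃ : ∀ k : ℤ, b₂ / b₃ ≠ q ^ k) :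
    qTheta q (b₂ / b₁) * qTheta q (l * b₂) * qTheta q (M * b₁ * b₂) /
        (b₂ * qTheta q (b₁ / b₂) * qTheta q (b₃ / b₂)) +
      qTheta q (b₃ / b₁) * qTheta q (l * b₃) * qTheta q (M * b₁ * b₃) /
        (b₃ * qTheta q (b₁ / b₃) * qTheta q (b₂ / b₃)) = 0 := by
  have n₁₂ := qTheta_ne_zero hq hq0 (div_ne_zero hb₁ hb₂) h₁₂
  have n₁₃ := qTheta_ne_zero hq hq0 (div_ne_zero hb₁ hb₃) h₁₃
  have n₂₃ := qTheta_ne_zero hq hq0 (div_ne_zero hb₂ hb₃) h₂₃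
  have e1 : qTheta q (b₂ / b₁) = -(b₂ / b₁) * qTheta q (b₁ / b₂) := by
    rw [← inv_div, qTheta_inv hq hq0 (div_ne_zero hb₁ hb₂)]; field_simp
  have e2 : qTheta q (b₃ / b₁) = -(b₃ / b₁) * qTheta q (b₁ / b₃) := by
    rw [← inv_div, qTheta_inv hq hq0 (div_ne_zero hb₁ hb₃)]; field_simp
  have e3 : qTheta q (b₃ / b₂) = -(b₃ / b₂) * qTheta q (b₂ / b₃) := by
    rw [← inv_div, qTheta_inv hq hq0 (div_ne_zero hb₂ hb₃)]; field_simp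
  have e4 : qTheta q (M * b₁ * b₂) = -(l * b₃ / q) * qTheta q (l * b₃) := by
    have : M * b₁ * b₂ = q / (l * b₃ / q) := by
      field_simp; linear_combination hbal
    rw [this, qTheta_q_div hq0 (by positivity), qTheta_div_q hq hq0 (by positivity)]; ring
  have e5 : qTheta q (M * b₁ * b₃) = -(l * b₂ / q) * qTheta q (l * b₂) := by
    have : M * b₁ * b₃ = q / (l * b₂ / q) := by
      field_simp; linear_combination hbal
    rw [this, qTheta_q_div hq0 (by positivity), qTheta_div_q hq hq0 (by positivity)]; ring
  rw [e1, e2, e3, e4, e5]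
  field_simp
  ring

/-- The elliptic partial fraction identity in three variables. -/
theorem qTheta_partialFraction {b₁ b₂ b₃ l₁ l₂ l₃ : ℂ} (hb₁ : b₁ ≠ 0) (hb₂ : b₂ ≠ 0)
    (hb₃ : b₃ ≠ 0) (hl₁ : l₁ ≠ 0) (hl₂ : l₂ ≠ 0) (hl₃ : l₃ ≠ 0)
    (hbal : l₁ * l₂ * l₃ * b₁ * b₂ * b₃ = q ^ 2)
    (h₁₂ : ∀ k : ℤ, b₁ / b₂ ≠ q ^ k) (h₁₃ : ∀ k : ℤ, b₁ / b₃ ≠ q ^ k)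
    (h₂₃ : ∀ k : ℤ, b₂ / b₃ ≠ q ^ k) (h : ∀ k : ℤ, l₂ * b₃ ≠ q ^ k) :
    qTheta q (l₁ * b₁) * qTheta q (l₂ * b₁) * qTheta q (l₃ * b₁) /
        (b₁ * qTheta q (b₂ / b₁) * qTheta q (b₃ / b₁)) +
      qTheta q (l₁ * b₂) * qTheta q (l₂ * b₂) * qTheta q (l₃ * b₂) /
        (b₂ * qTheta q (b₁ / b₂) * qTheta q (b₃ / b₂)) +
      qTheta q (l₁ * b₃) * qTheta q (l₂ * b₃) * qTheta q (l₃ * b₃) /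
        (b₃ * qTheta q (b₁ / b₃) * qTheta q (b₂ / b₃)) = 0 := by
  -- With l₁l₃ fixed, the sum is a degree-two theta function of x = l₁, as l₃ = M/x. Its zeros are
  -- at 1/b₁ and 1/b₂.
  set M := l₁ * l₃ with hM
  have hM0 : M ≠ 0 := mul_ne_zero hl₁ hl₃
  have hMb : ∀ {b : ℂ}, b ≠ 0 → M * b ≠ 0 := fun hb => mul_ne_zero hM0 hb
  have key := eq_zero_of_q_mul_eq_of_zeros hq hq0 (C := M / q) (u := b₁⁻¹) (v := b₂⁻¹)
    (f := fun x =>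
      qTheta q (x * b₁) * qTheta q (M * b₁ / x) *
        (qTheta q (l₂ * b₁) / (b₁ * qTheta q (b₂ / b₁) * qTheta q (b₃ / b₁))) +
      qTheta q (x * b₂) * qTheta q (M * b₂ / x) *
        (qTheta q (l₂ * b₂) / (b₂ * qTheta q (b₁ / b₂) * qTheta q (b₃ / b₂))) +
      qTheta q (x * b₃) * qTheta q (M * b₃ / x) *
        (qTheta q (l₂ * b₃) / (b₃ * qTheta q (b₁ / b₃) * qTheta q (b₂ / b₃))))
    ?_ (div_ne_zero hM0 hq0) ?_ (inv_ne_zero hb₁) (inv_ne_zero hb₂) ?_ ?_ ?_ ?_ l₁ hl₁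
  · have e : ∀ b, M * b / l₁ = l₃ * b := fun b => by rw [hM]; field_simp
    simp only [e] at key
    linear_combination key
  · have d := @differentiableOn_qTheta_mul q hq
    have d' := @differentiableOn_qTheta_const_div q hq
    exact ((((d hb₁).mul (d' (hMb hb₁))).mul_const _).add
      (((d hb₂).mul (d' (hMb hb₂))).mul_const _)).add
      (((d hb₃).mul (d' (hMb hb₃))).mul_const _)
  · intro x hx
    have t : ∀ {b : ℂ}, b ≠ 0 → qTheta q (q * x * b) * qTheta q (M * b / (q * x)) =
        M / q / x ^ 2 * (qTheta q (x * b) * qTheta q (M * b / x)) := by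
      intro b hb
      rw [qTheta_q_mul_mul hq hq0 hx hb, qTheta_div_q_mul hq hq0 hx (hMb hb)]; field_simp
    simp only [t hb₁, t hb₂, t hb₃]
    ring
  · have := qTheta_partialFraction_aux hq hq0 hb₁ hb₂ hb₃ hl₂ (M := M)
      (by rw [hM]; linear_combination hbal) h₁₂ h₁₃ h₂₃
    have e : ∀ b, M * b / b₁⁻¹ = M * b₁ * b := fun b => by field_simp
    have e' : ∀ b, b₁⁻¹ * b = b / b₁ := fun b => by field_simp
    simp only [e, e', div_self hb₁, qTheta_one hq]
    linear_combination this
  · have h₂₁ : ∀ k : ℤ, b₂ / b₁ ≠ q ^ k := fun k hk => h₁₂ (-k) (by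
      rw [zpow_neg, ← hk, inv_div])
    have := qTheta_partialFraction_aux hq hq0 hb₂ hb₁ hb₃ hl₂ (M := M)
      (by rw [hM]; linear_combination hbal) h₂₁ h₂₃ h₁₃
    have e : ∀ b, M * b / b₂⁻¹ = M * b₂ * b := fun b => by field_simp
    have e' : ∀ b, b₂⁻¹ * b = b / b₂ := fun b => by field_simp
    simp only [e, e', div_self hb₂, qTheta_one hq]
    linear_combination this
  · intro k hk
    refine h₁₂ k ?_
    rw [← hk]; field_simp
  · intro k hk
    -- By balancing, C/(uv) = M b₁ b₂/q = q/(l₂ b₃).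
    refine h (1 - k) ?_
    rw [zpow_sub₀ hq0, zpow_one, ← hk, eq_div_iff (by positivity)]
    field_simp
    rw [hM]; linear_combination hbal

end

/-! ### Balanced ₃φ₂ series and their contiguous relation -/

/-- The general term of the basic hypergeometric series `₃φ₂(x₁, x₂, x₃; c, d; q, q)`. -/
noncomputable def phi32Term (q x₁ x₂ x₃ c d : ℂ) (k : ℕ) : ℂ :=
  q ^ k * (qPoch q x₁ k * qPoch q x₂ k * qPoch q x₃ k) /
    (qPoch q q k * qPoch q c k * qPoch q d k)

/-- The basic hypergeometric series `₃φ₂(x₁, x₂, x₃; c, d; q, q)`. -/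
noncomputable def phi32 (q x₁ x₂ x₃ c d : ℂ) : ℂ := ∑' k, phi32Term q x₁ x₂ x₃ c d k

theorem phi32Term_comm (q x₁ x₂ x₃ c d : ℂ) :
    phi32Term q x₁ x₂ x₃ c d = phi32Term q x₁ x₂ x₃ d c := by
  ext k; rw [phi32Term, phi32Term]; ring

theorem phi32_comm (q x₁ x₂ x₃ c d : ℂ) : phi32 q x₁ x₂ x₃ c d = phi32 q x₁ x₂ x₃ d c := by
  rw [phi32, phi32Term_comm]; rfl

theorem phi32_one (q x₂ x₃ c d : ℂ) : phi32 q 1 x₂ x₃ c d = 1 := by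
  rw [phi32, tsum_eq_single 0]
  · simp [phi32Term, qPoch_zero]
  · intro k hk
    simp [phi32Term, qPoch_one_eq_zero q hk]

section

variable {q : ℂ} (hq : ‖q‖ < 1)
include hq

/-- The majorant is geometric in `k` and uniform over numerator parameters of modulus at most `r`,
so it gives both convergence of the series and holomorphy in the parameters. -/
theorem norm_phi32Term_le {x₁ x₂ x₃ c d : ℂ} (hc : qPochInf q c ≠ 0) (hd : qPochInf q d ≠ 0)
    {r : ℝ} (h₁ : ‖x₁‖ ≤ r) (h₂ : ‖x₂‖ ≤ r) (h₃ : ‖x₃‖ ≤ r) (k : ℕ) :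
    ‖phi32Term q x₁ x₂ x₃ c d k‖ ≤ ‖q‖ ^ k * (Real.exp (r / (1 - ‖q‖)) ^ 3 *
      ((Real.exp (‖q‖ / (1 - ‖q‖)) * ‖(qPochInf q q)⁻¹‖) *
       (Real.exp (‖c‖ / (1 - ‖q‖)) * ‖(qPochInf q c)⁻¹‖) *
       (Real.exp (‖d‖ / (1 - ‖q‖)) * ‖(qPochInf q d)⁻¹‖))) := by
  have hb : ∀ x : ℂ, ‖x‖ ≤ r → ‖qPoch q x k‖ ≤ Real.exp (r / (1 - ‖q‖)) := fun x hx =>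
    (norm_qPoch_le hq x k).trans (Real.exp_le_exp.2 (div_le_div_of_nonneg_right hx (by linarith)))
  have e : phi32Term q x₁ x₂ x₃ c d k = q ^ k * ((qPoch q x₁ k * qPoch q x₂ k * qPoch q x₃ k) *
      ((qPoch q q k)⁻¹ * (qPoch q c k)⁻¹ * (qPoch q d k)⁻¹)) := by
    rw [phi32Term, div_eq_mul_inv, mul_inv, mul_inv]; ring
  rw [e, norm_mul, norm_pow, pow_three', norm_mul, norm_mul, norm_mul, norm_mul, norm_mul]
  gcongr
  · exact hb _ h₁
  · exact hb _ h₂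
  · exact hb _ h₃
  · exact norm_inv_qPoch_le hq (qPochInf_self_ne_zero hq) k
  · exact norm_inv_qPoch_le hq hc k
  · exact norm_inv_qPoch_le hq hd k

theorem summable_phi32Term (x₁ x₂ x₃ : ℂ) {c d : ℂ} (hc : qPochInf q c ≠ 0)
    (hd : qPochInf q d ≠ 0) : Summable (phi32Term q x₁ x₂ x₃ c d) := by
  refine Summable.of_norm_bounded ((summable_geometric_of_lt_one (norm_nonneg _) hq).mul_right _)
    (norm_phi32Term_le hq hc hd (r := max ‖x₁‖ (max ‖x₂‖ ‖x₃‖)) ?_ ?_ ?_) <;> simp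

theorem differentiableOn_phi32 (b κ x₃ : ℂ) {c d : ℂ} (hc : qPochInf q c ≠ 0)
    (hd : qPochInf q d ≠ 0) :
    DifferentiableOn ℂ (fun x => phi32 q (x * b) (κ / x * b) x₃ c d) {0}ᶜ := by
  intro x₀ hx₀
  have hx₀ : 0 < ‖x₀‖ := norm_pos_iff.2 hx₀
  refine DifferentiableAt.differentiableWithinAt ?_
  have hs : Metric.ball x₀ (‖x₀‖ / 2) ∈ 𝓝 x₀ := Metric.ball_mem_nhds _ (by positivity)
  refine DifferentiableOn.differentiableAt ?_ hs
  have hlow : ∀ x ∈ Metric.ball x₀ (‖x₀‖ / 2), ‖x₀‖ / 2 ≤ ‖x‖ ∧ ‖x‖ ≤ 2 * ‖x₀‖ := by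
    intro x hx
    have h1 : ‖x - x₀‖ < ‖x₀‖ / 2 := by simpa [dist_eq_norm] using hx
    have h2 := norm_sub_norm_le x₀ x
    have h3 := norm_sub_norm_le x x₀
    rw [norm_sub_rev] at h2
    constructor <;> linarith
  have hne : ∀ x ∈ Metric.ball x₀ (‖x₀‖ / 2), x ≠ 0 := fun x hx =>
    norm_pos_iff.1 (lt_of_lt_of_le (by positivity) (hlow x hx).1)
  set r := max (2 * ‖x₀‖ * ‖b‖) (max (‖κ‖ / (‖x₀‖ / 2) * ‖b‖) ‖x₃‖) with hr
  unfold phi32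
  refine Complex.differentiableOn_tsum_of_summable_norm
    ((summable_geometric_of_lt_one (norm_nonneg _) hq).mul_right _) ?_ Metric.isOpen_ball
    fun k x hx => norm_phi32Term_le hq hc hd (r := r) ?_ ?_ ?_ k
  · intro k x hx
    have h := differentiable_qPoch q k
    refine DifferentiableAt.differentiableWithinAt ?_
    unfold phi32Term
    have h1 : DifferentiableAt ℂ (fun x => qPoch q (x * b) k) x :=
      DifferentiableAt.comp (g := fun a => qPoch q a k) (f := fun x => x * b) x (h (x * b))
        (differentiableAt_id.mul_const b)
    have h2 : DifferentiableAt ℂ (fun x => qPoch q (κ / x * b) k) x :=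
      DifferentiableAt.comp (g := fun a => qPoch q a k) (f := fun x => κ / x * b) x
        (h (κ / x * b)) (((differentiableAt_const κ).div differentiableAt_id (hne x hx)).mul_const b)
    exact (((h1.mul h2).mul_const _).const_mul _).div_const _
  · rw [norm_mul]
    exact (mul_le_mul_of_nonneg_right (hlow x hx).2 (norm_nonneg _)).trans (le_max_left _ _)
  · rw [norm_mul, norm_div]
    refine le_trans ?_ ((le_max_left _ _).trans (le_max_right _ _))
    gcongr
    exact (hlow x hx).1
  · exact (le_max_right _ _).trans (le_max_right _ _)

variable (hq0 : q ≠ 0)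
include hq0

/-- A contiguous relation for a `₃φ₂` series with argument `q`. -/
theorem phi32_contiguous {x₁ x₂ x₃ c d : ℂ} (hx₁ : x₁ ≠ 0) (hc0 : c ≠ 0) (hd0 : d ≠ 0)
    (hc : qPochInf q c ≠ 0) (hd : qPochInf q d ≠ 0) (hbal : x₁ * x₂ * x₃ * q ^ 2 = c * d) :
    (1 - x₂) * (1 - x₂ * (q / c)) * (1 - x₂ * (q / d)) *
          ((1 - x₁) * phi32 q (q * x₁) x₂ x₃ c d)
        - x₂ / x₁ * ((1 - x₁) * (1 - x₁ * (q / c)) * (1 - x₁ * (q / d))) *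
          ((1 - x₂) * phi32 q x₁ (q * x₂) x₃ c d)
      = x₂ * (x₂ - x₁) * (q / c) * (q / d) *
        ((qPochInf q x₁ * qPochInf q x₂ * qPochInf q x₃) /
          (qPochInf q q * qPochInf q c * qPochInf q d)) := by
  set W := (1 - x₂) * (1 - x₂ * (q / c)) * (1 - x₂ * (q / d)) with hW
  set V := x₂ / x₁ * ((1 - x₁) * (1 - x₁ * (q / c)) * (1 - x₁ * (q / d))) with hV
  set t := phi32Term q x₁ x₂ x₃ c d with ht
  have hshift : ∀ (x : ℂ) (k : ℕ), (1 - x) * qPoch q (q * x) k = qPoch q x k * (1 - x * q ^ k) := by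
    intro x k
    rw [← qPoch_succ, qPoch_succ', mul_comm x q]
  have s₁ : HasSum (fun k => t k * (1 - x₁ * q ^ k)) ((1 - x₁) * phi32 q (q * x₁) x₂ x₃ c d) := by
    refine ((summable_phi32Term hq (q * x₁) x₂ x₃ hc hd).hasSum.mul_left (1 - x₁)).congr_fun ?_
    intro k
    simp only [ht, phi32Term]
    linear_combination (-(q ^ k * (qPoch q x₂ k * qPoch q x₃ k) /
      (qPoch q q k * qPoch q c k * qPoch q d k))) * hshift x₁ k
  have s₂ : HasSum (fun k => t k * (1 - x₂ * q ^ k)) ((1 - x₂) * phi32 q x₁ (q * x₂) x₃ c d) := by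
    refine ((summable_phi32Term hq x₁ (q * x₂) x₃ hc hd).hasSum.mul_left (1 - x₂)).congr_fun ?_
    intro k
    simp only [ht, phi32Term]
    linear_combination (-(q ^ k * (qPoch q x₁ k * qPoch q x₃ k) /
      (qPoch q q k * qPoch q c k * qPoch q d k))) * hshift x₂ k
  have s := (s₁.mul_left W).sub (s₂.mul_left V)
  set p : ℕ → ℂ := fun k => (qPoch q x₁ k * qPoch q x₂ k * qPoch q x₃ k) /
    (qPoch q q k * qPoch q c k * qPoch q d k) with hp
  have htp : ∀ k, t k = q ^ k * p k := fun k => by rw [ht, phi32Term, hp]; ring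
  -- `R` is the telescoping certificate. It vanishes at k = 0 through the factor q^k - 1, and its
  -- limit as k → ∞ produces the infinite product on the right side.
  set R : ℕ → ℂ := fun k => p k * ((q ^ k - 1) * (q ^ k - q / c) * (q ^ k - q / d)) with hR
  have hqq := qPochInf_self_ne_zero hq
  have hR1 : ∀ k, R (k + 1) = -(p k * ((q / c) * (q / d) *
      ((1 - x₁ * q ^ k) * (1 - x₂ * q ^ k) * (1 - x₃ * q ^ k)))) := by
    intro k
    have n1 := qPoch_ne_zero hq hqq (k + 1)
    have n2 := qPoch_ne_zero hq hc (k + 1)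
    have n3 := qPoch_ne_zero hq hd (k + 1)
    rw [qPoch_succ] at n1 n2 n3
    obtain ⟨n1, n1'⟩ := mul_ne_zero_iff.1 n1
    obtain ⟨n2, n2'⟩ := mul_ne_zero_iff.1 n2
    obtain ⟨n3, n3'⟩ := mul_ne_zero_iff.1 n3
    have e2 : q ^ (k + 1) - q / c = -(q / c) * (1 - c * q ^ k) := by field_simp; ring
    have e3 : q ^ (k + 1) - q / d = -(q / d) * (1 - d * q ^ k) := by field_simp; ring
    have e1 : q ^ (k + 1) - 1 = -(1 - q * q ^ k) := by ring
    simp only [hR, hp, qPoch_succ, e1, e2, e3]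
    generalize 1 - q * q ^ k = D₁ at *
    generalize 1 - c * q ^ k = D₂ at *
    generalize 1 - d * q ^ k = D₃ at *
    field_simp
  have hstep : ∀ k, W * (t k * (1 - x₁ * q ^ k)) - V * (t k * (1 - x₂ * q ^ k)) =
      x₂ * (x₂ - x₁) * (R k - R (k + 1)) := by
    intro k
    rw [hR1, htp, hW, hV]
    simp only [hR]
    generalize p k = P
    generalize q ^ k = Q
    -- Without balancing, the telescoping identity fails by exactly a multiple of x₁x₂x₃q² - cd.
    have key : (1 - x₂) * (1 - x₂ * (q / c)) * (1 - x₂ * (q / d)) * (Q * P * (1 - x₁ * Q)) -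
        x₂ / x₁ * ((1 - x₁) * (1 - x₁ * (q / c)) * (1 - x₁ * (q / d))) * (Q * P * (1 - x₂ * Q)) -
        x₂ * (x₂ - x₁) * (P * ((Q - 1) * (Q - q / c) * (Q - q / d)) -
          -(P * (q / c * (q / d) * ((1 - x₁ * Q) * (1 - x₂ * Q) * (1 - x₃ * Q))))) =
        (x₂ - x₁) / (x₁ * c * d) * P * Q * (1 - x₁ * Q) * (1 - x₂ * Q) *
          (x₁ * x₂ * x₃ * q ^ 2 - c * d) := by
      field_simp
      ring
    rw [hbal, sub_self, mul_zero] at key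
    exact sub_eq_zero.1 key
  have hp_lim : Tendsto p atTop (𝓝 ((qPochInf q x₁ * qPochInf q x₂ * qPochInf q x₃) /
      (qPochInf q q * qPochInf q c * qPochInf q d))) :=
    (((qPoch_tendsto hq x₁).mul (qPoch_tendsto hq x₂)).mul (qPoch_tendsto hq x₃)).div
      (((qPoch_tendsto hq q).mul (qPoch_tendsto hq c)).mul (qPoch_tendsto hq d))
      (mul_ne_zero (mul_ne_zero hqq hc) hd)
  have hqk : Tendsto (fun k : ℕ => q ^ k) atTop (𝓝 0) :=
    tendsto_pow_atTop_nhds_zero_of_norm_lt_one hq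
  have hR_lim := hp_lim.mul (((hqk.sub_const 1).mul (hqk.sub_const (q / c))).mul
    (hqk.sub_const (q / d)))
  have hsum : ∀ n, ∑ k ∈ Finset.range n,
      (W * (t k * (1 - x₁ * q ^ k)) - V * (t k * (1 - x₂ * q ^ k))) =
      x₂ * (x₂ - x₁) * (R 0 - R n) := by
    intro n
    rw [Finset.sum_congr rfl fun k _ => hstep k, ← Finset.mul_sum, Finset.sum_range_sub']
  have hlim := s.tendsto_sum_nat
  simp only [hsum] at hlim
  refine tendsto_nhds_unique hlim ?_
  have h2 := (hR_lim.const_sub (R 0)).const_mul (x₂ * (x₂ - x₁))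
  refine h2.congr' ?_ |>.trans_eq ?_
  · exact Eventually.of_forall fun n => rfl
  · congr 1
    simp only [hR]
    ring

end

/-! ### The sum over the three sequences of poles -/

/-- The contribution of the poles `b₁ q^k` to the contour integral, up to normalization;
`f` is the value of the numerator at `b₁`. -/
noncomputable def poleSum (q a₁ a₂ a₃ b₁ b₂ b₃ f : ℂ) : ℂ :=
  f / (qPochInf q (b₂ / b₁) * qPochInf q (b₃ / b₁)) *
    (qPochInf q (a₁ * b₂) * qPochInf q (a₂ * b₂) * qPochInf q (a₃ * b₂) *
      (qPochInf q (a₁ * b₃) * qPochInf q (a₂ * b₃) * qPochInf q (a₃ * b₃))) *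
    phi32 q (a₁ * b₁) (a₂ * b₁) (a₃ * b₁) (q * b₁ / b₂) (q * b₁ / b₃)

/-- The sum of the contributions of all three sequences of poles. -/
noncomputable def totalPoleSum (q a₁ a₂ a₃ b₁ b₂ b₃ : ℂ) (f : ℂ → ℂ) : ℂ :=
  poleSum q a₁ a₂ a₃ b₁ b₂ b₃ (f b₁) + poleSum q a₁ a₂ a₃ b₂ b₁ b₃ (f b₂) +
    poleSum q a₁ a₂ a₃ b₃ b₁ b₂ (f b₃)

theorem poleSum_comm (q a₁ a₂ a₃ b₁ b₂ b₃ f : ℂ) :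
    poleSum q a₁ a₂ a₃ b₁ b₂ b₃ f = poleSum q a₁ a₂ a₃ b₁ b₃ b₂ f := by
  rw [poleSum, poleSum, phi32_comm]; ring

theorem totalPoleSum_swap (q a₁ a₂ a₃ b₁ b₂ b₃ : ℂ) (f : ℂ → ℂ) :
    totalPoleSum q a₁ a₂ a₃ b₁ b₂ b₃ f = totalPoleSum q a₁ a₂ a₃ b₂ b₁ b₃ f := by
  rw [totalPoleSum, totalPoleSum, poleSum_comm q a₁ a₂ a₃ b₃ b₁ b₂]; ring

theorem ne_zpow_inv {q x y : ℂ} (h : ∀ k : ℤ, x / y ≠ q ^ k) : ∀ k : ℤ, y / x ≠ q ^ k :=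
  fun k hk => h (-k) (by rw [zpow_neg, ← hk, inv_div])

section

variable {q : ℂ} (hq : ‖q‖ < 1) (hq0 : q ≠ 0)
include hq hq0

theorem qPochInf_q_mul_div_ne_zero {x y : ℂ} (hx : x ≠ 0) (hy : y ≠ 0)
    (h : ∀ k : ℤ, x / y ≠ q ^ k) : qPochInf q (q * x / y) ≠ 0 := by
  have h1 := qTheta_ne_zero hq hq0 (div_ne_zero hy hx) (ne_zpow_inv h)
  rw [qTheta] at h1
  have e : q / (y / x) = q * x / y := by field_simp
  rw [← e]
  exact right_ne_zero_of_mul h1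

/-- This is the contiguous relation multiplied by the prefactor of `poleSum`. On the right,
everything but the last factor is symmetric in b₁, b₂, b₃, so it can be pulled out when the three
sequences are added. -/
theorem poleSum_shift {a₁ a₂ a₃ b₁ b₂ b₃ : ℂ} (f : ℂ) (ha₁ : a₁ ≠ 0)
    (hb₁ : b₁ ≠ 0) (hb₂ : b₂ ≠ 0) (hb₃ : b₃ ≠ 0)
    (hbal : a₁ * a₂ * a₃ * b₁ * b₂ * b₃ = 1)
    (h₁₂ : ∀ k : ℤ, b₁ / b₂ ≠ q ^ k) (h₁₃ : ∀ k : ℤ, b₁ / b₃ ≠ q ^ k)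
    (hu₁ : 1 - a₁ * b₁ ≠ 0) (hu₂ : 1 - a₁ * b₂ ≠ 0) (hu₃ : 1 - a₁ * b₃ ≠ 0)
    (hw₁ : 1 - a₂ * b₁ ≠ 0) (hw₂ : 1 - a₂ * b₂ ≠ 0) (hw₃ : 1 - a₂ * b₃ ≠ 0) :
    poleSum q (q * a₁) a₂ a₃ b₁ b₂ b₃ f - a₂ / a₁ * poleSum q a₁ (q * a₂) a₃ b₁ b₂ b₃ f =
      a₂ * (a₂ - a₁) * (b₁ * b₂ * b₃) *
        (qPochInf q (a₁ * b₁) * qPochInf q (a₂ * b₁) * qPochInf q (a₃ * b₁) *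
         (qPochInf q (a₁ * b₂) * qPochInf q (a₂ * b₂) * qPochInf q (a₃ * b₂)) *
         (qPochInf q (a₁ * b₃) * qPochInf q (a₂ * b₃) * qPochInf q (a₃ * b₃))) /
        ((1 - a₁ * b₁) * (1 - a₁ * b₂) * (1 - a₁ * b₃) *
         ((1 - a₂ * b₁) * (1 - a₂ * b₂) * (1 - a₂ * b₃)) * qPochInf q q) *
        (f / (b₁ * qTheta q (b₂ / b₁) * qTheta q (b₃ / b₁))) := by
  have hc := qPochInf_q_mul_div_ne_zero hq hq0 hb₁ hb₂ h₁₂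
  have hd := qPochInf_q_mul_div_ne_zero hq hq0 hb₁ hb₃ h₁₃
  have hθ₂ := qTheta_ne_zero hq hq0 (div_ne_zero hb₂ hb₁) (ne_zpow_inv h₁₂)
  have hθ₃ := qTheta_ne_zero hq hq0 (div_ne_zero hb₃ hb₁) (ne_zpow_inv h₁₃)
  have e₂ : q / (b₂ / b₁) = q * b₁ / b₂ := by field_simp
  have e₃ : q / (b₃ / b₁) = q * b₁ / b₃ := by field_simp
  have hqq := qPochInf_self_ne_zero hq
  rw [qTheta, e₂] at hθ₂
  rw [qTheta, e₃] at hθ₃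
  have hv₂ := left_ne_zero_of_mul hθ₂
  have hv₃ := left_ne_zero_of_mul hθ₃
  have key := phi32_contiguous hq hq0 (x₁ := a₁ * b₁) (x₂ := a₂ * b₁) (x₃ := a₃ * b₁)
    (mul_ne_zero ha₁ hb₁) (div_ne_zero (mul_ne_zero hq0 hb₁) hb₂)
    (div_ne_zero (mul_ne_zero hq0 hb₁) hb₃) hc hd
    (by field_simp; linear_combination hbal)
  have c₁ : ∀ a, a * b₁ * (q / (q * b₁ / b₂)) = a * b₂ := fun a => by field_simp
  have c₂ : ∀ a, a * b₁ * (q / (q * b₁ / b₃)) = a * b₃ := fun a => by field_simp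
  have c₃ : a₂ * b₁ / (a₁ * b₁) = a₂ / a₁ := by field_simp
  have c₄ : a₂ * b₁ * (a₂ * b₁ - a₁ * b₁) * (q / (q * b₁ / b₂)) * (q / (q * b₁ / b₃)) =
      a₂ * (a₂ - a₁) * b₂ * b₃ := by field_simp
  rw [c₁, c₁, c₂, c₂, c₃, c₄] at key
  have hs : ∀ a b : ℂ, qPochInf q (a * b) = (1 - a * b) * qPochInf q (q * a * b) := fun a b => by
    rw [qPochInf_eq_one_sub_mul hq (a * b)]; congr 2; ring
  rw [poleSum, poleSum, qTheta, qTheta, e₂, e₃, mul_assoc q a₁ b₁, mul_assoc q a₂ b₁,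
    hs a₁ b₂, hs a₁ b₃, hs a₂ b₂, hs a₂ b₃]
  generalize qPochInf q (q * a₁ * b₂) = y₁₂ at *
  generalize qPochInf q (q * a₁ * b₃) = y₁₃ at *
  generalize qPochInf q (q * a₂ * b₂) = y₂₂ at *
  generalize qPochInf q (q * a₂ * b₃) = y₂₃ at *
  generalize phi32 q (q * (a₁ * b₁)) _ _ _ _ = Φ₁ at *
  generalize phi32 q _ (q * (a₂ * b₁)) _ _ _ = Φ₂ at *
  generalize qPochInf q (a₃ * b₂) = p₃₂ at *
  generalize qPochInf q (a₃ * b₃) = p₃₃ at *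
  generalize qPochInf q (a₁ * b₁) = p₁₁ at *
  generalize qPochInf q (a₂ * b₁) = p₂₁ at *
  generalize qPochInf q (a₃ * b₁) = p₃₁ at *
  generalize qPochInf q (b₂ / b₁) = v₂ at *
  generalize qPochInf q (b₃ / b₁) = v₃ at *
  generalize qPochInf q (q * b₁ / b₂) = c at *
  generalize qPochInf q (q * b₁ / b₃) = d at *
  generalize qPochInf q q = Q at *
  generalize a₂ - a₁ = δ at *
  generalize 1 - a₁ * b₁ = u₁ at *
  generalize 1 - a₁ * b₂ = u₂ at *
  generalize 1 - a₁ * b₃ = u₃ at *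
  generalize 1 - a₂ * b₁ = w₁ at *
  generalize 1 - a₂ * b₂ = w₂ at *
  generalize 1 - a₂ * b₃ = w₃ at *
  -- The relation is solved for the first series; the nonvanishing factors 1 - a b are what this
  -- divides by.
  have hΦ : Φ₁ = (a₂ / a₁ * (u₁ * u₂ * u₃) * (w₁ * Φ₂) +
      a₂ * δ * b₂ * b₃ * (p₁₁ * p₂₁ * p₃₁ / (Q * c * d))) / (w₁ * w₂ * w₃ * u₁) := by
    rw [eq_div_iff (by positivity)]
    linear_combination key
  rw [hΦ]
  field_simp
  ring

/-- The three error terms in `poleSum_shift` share a common factor, which multiplies the sum in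
`hf`. For the numerator ∏ θ(l_i b) that sum vanishes by `qTheta_partialFraction`. -/
theorem totalPoleSum_shift {a₁ a₂ a₃ b₁ b₂ b₃ : ℂ} (f : ℂ → ℂ) (ha₁ : a₁ ≠ 0)
    (hb₁ : b₁ ≠ 0) (hb₂ : b₂ ≠ 0) (hb₃ : b₃ ≠ 0)
    (hbal : a₁ * a₂ * a₃ * b₁ * b₂ * b₃ = 1)
    (h₁₂ : ∀ k : ℤ, b₁ / b₂ ≠ q ^ k) (h₁₃ : ∀ k : ℤ, b₁ / b₃ ≠ q ^ k)
    (h₂₃ : ∀ k : ℤ, b₂ / b₃ ≠ q ^ k)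
    (hu₁ : 1 - a₁ * b₁ ≠ 0) (hu₂ : 1 - a₁ * b₂ ≠ 0) (hu₃ : 1 - a₁ * b₃ ≠ 0)
    (hw₁ : 1 - a₂ * b₁ ≠ 0) (hw₂ : 1 - a₂ * b₂ ≠ 0) (hw₃ : 1 - a₂ * b₃ ≠ 0)
    (hf : f b₁ / (b₁ * qTheta q (b₂ / b₁) * qTheta q (b₃ / b₁)) +
      f b₂ / (b₂ * qTheta q (b₁ / b₂) * qTheta q (b₃ / b₂)) +
      f b₃ / (b₃ * qTheta q (b₁ / b₃) * qTheta q (b₂ / b₃)) = 0) :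
    totalPoleSum q (q * a₁) a₂ a₃ b₁ b₂ b₃ f =
      a₂ / a₁ * totalPoleSum q a₁ (q * a₂) a₃ b₁ b₂ b₃ f := by
  have s₁ := poleSum_shift hq hq0 (f b₁) ha₁ hb₁ hb₂ hb₃ hbal h₁₂ h₁₃ hu₁ hu₂ hu₃ hw₁ hw₂ hw₃
  have s₂ := poleSum_shift hq hq0 (f b₂) ha₁ hb₂ hb₁ hb₃ (a₂ := a₂) (a₃ := a₃)
    (by linear_combination hbal) (ne_zpow_inv h₁₂) h₂₃ hu₂ hu₁ hu₃ hw₂ hw₁ hw₃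
  have s₃ := poleSum_shift hq hq0 (f b₃) ha₁ hb₃ hb₁ hb₂ (a₂ := a₂) (a₃ := a₃)
    (by linear_combination hbal) (ne_zpow_inv h₁₃) (ne_zpow_inv h₂₃) hu₃ hu₁ hu₂ hw₃ hw₁ hw₂
  rw [totalPoleSum, totalPoleSum]
  linear_combination s₁ + s₂ + s₃ + (a₂ * (a₂ - a₁) * (b₁ * b₂ * b₃) *
        (qPochInf q (a₁ * b₁) * qPochInf q (a₂ * b₁) * qPochInf q (a₃ * b₁) *
         (qPochInf q (a₁ * b₂) * qPochInf q (a₂ * b₂) * qPochInf q (a₃ * b₂)) *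
         (qPochInf q (a₁ * b₃) * qPochInf q (a₂ * b₃) * qPochInf q (a₃ * b₃))) /
        ((1 - a₁ * b₁) * (1 - a₁ * b₂) * (1 - a₁ * b₃) *
         ((1 - a₂ * b₁) * (1 - a₂ * b₂) * (1 - a₂ * b₃)) * qPochInf q q)) * hf

theorem differentiableOn_poleSum (κ a₃ : ℂ) {b₁ b₂ b₃ : ℂ} (f : ℂ) (hb₁ : b₁ ≠ 0) (hb₂ : b₂ ≠ 0)
    (hb₃ : b₃ ≠ 0) (h₁₂ : ∀ k : ℤ, b₁ / b₂ ≠ q ^ k) (h₁₃ : ∀ k : ℤ, b₁ / b₃ ≠ q ^ k) :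
    DifferentiableOn ℂ (fun x => poleSum q x (κ / x) a₃ b₁ b₂ b₃ f) {0}ᶜ := by
  have h := differentiable_qPochInf hq
  have d₁ : ∀ b : ℂ, DifferentiableOn ℂ (fun x => qPochInf q (x * b)) {0}ᶜ := fun b =>
    (h.comp (differentiable_id.mul_const b)).differentiableOn
  have d₂ : ∀ b : ℂ, DifferentiableOn ℂ (fun x => qPochInf q (κ / x * b)) {0}ᶜ := fun b =>
    h.comp_differentiableOn
      (((differentiableOn_const κ).div differentiableOn_id fun x hx => hx).mul_const b)
  exact (((((d₁ b₂).mul (d₂ b₂)).mul_const _).mul (((d₁ b₃).mul (d₂ b₃)).mul_const _)).const_mul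
    _).mul (differentiableOn_phi32 hq b₁ κ _ (qPochInf_q_mul_div_ne_zero hq hq0 hb₁ hb₂ h₁₂)
      (qPochInf_q_mul_div_ne_zero hq hq0 hb₁ hb₃ h₁₃))

/-- For a₁b₁ = 1 the other two contributions contain (1)_∞ = 0 and the remaining series stops after
its first term. Balancing then pairs the surviving products into theta functions. -/
theorem totalPoleSum_inv {a₂ a₃ b₁ b₂ b₃ : ℂ} (f : ℂ → ℂ) (ha₂ : a₂ ≠ 0)
    (hb₁ : b₁ ≠ 0) (hb₂ : b₂ ≠ 0) (hb₃ : b₃ ≠ 0) (hbal : a₂ * a₃ * b₂ * b₃ = q)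
    (h₁₂ : ∀ k : ℤ, b₁ / b₂ ≠ q ^ k) (h₁₃ : ∀ k : ℤ, b₁ / b₃ ≠ q ^ k) :
    totalPoleSum q b₁⁻¹ a₂ a₃ b₁ b₂ b₃ f =
      f b₁ * qTheta q (a₂ * b₂) * qTheta q (a₂ * b₃) := by
  have hθ₂ := qTheta_ne_zero hq hq0 (div_ne_zero hb₂ hb₁) (ne_zpow_inv h₁₂)
  have hθ₃ := qTheta_ne_zero hq hq0 (div_ne_zero hb₃ hb₁) (ne_zpow_inv h₁₃)
  have hv₂ := left_ne_zero_of_mul hθ₂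
  have hv₃ := left_ne_zero_of_mul hθ₃
  have e₁ : q / (a₂ * b₂) = a₃ * b₃ := by field_simp; linear_combination -hbal
  have e₂ : q / (a₂ * b₃) = a₃ * b₂ := by field_simp; linear_combination -hbal
  simp only [totalPoleSum, poleSum, inv_mul_cancel₀ hb₁, qPochInf_one hq, phi32_one, qTheta, e₁, e₂,
    inv_mul_eq_div]
  field_simp
  ring

/-- The nonterminating summation behind the integral, for generic parameters. -/
theorem totalPoleSum_eq {a₁ a₂ a₃ b₁ b₂ b₃ l₁ l₂ l₃ : ℂ} (ha₁ : a₁ ≠ 0) (ha₂ : a₂ ≠ 0)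
    (ha₃ : a₃ ≠ 0) (hb₁ : b₁ ≠ 0) (hb₂ : b₂ ≠ 0) (hb₃ : b₃ ≠ 0)
    (hl₁ : l₁ ≠ 0) (hl₂ : l₂ ≠ 0) (hl₃ : l₃ ≠ 0)
    (hbal : a₁ * a₂ * a₃ * b₁ * b₂ * b₃ = q) (hlam : l₁ * l₂ * l₃ = q * (a₁ * a₂ * a₃))
    (h₁₂ : ∀ k : ℤ, b₁ / b₂ ≠ q ^ k) (h₁₃ : ∀ k : ℤ, b₁ / b₃ ≠ q ^ k)
    (h₂₃ : ∀ k : ℤ, b₂ / b₃ ≠ q ^ k) (hlb : ∀ k : ℤ, l₂ * b₃ ≠ q ^ k)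
    (hab : ∀ k : ℤ, a₃ * b₃ ≠ q ^ k) (hal : ∀ k : ℤ, a₃ / l₂ ≠ q ^ k)
    (g₁ : ∀ k : ℤ, a₁ * a₂ * b₁ / l₂ ≠ q ^ k) (g₂ : ∀ k : ℤ, a₁ * a₂ * b₂ / l₂ ≠ q ^ k) :
    totalPoleSum q a₁ a₂ a₃ b₁ b₂ b₃
        (fun b => qTheta q (l₁ * b) * qTheta q (l₂ * b) * qTheta q (l₃ * b)) * qTheta q (l₁ / l₂) =
      qTheta q (l₁ / a₁) * qTheta q (l₁ / a₂) * qTheta q (l₁ / a₃) *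
          (qTheta q (l₂ * b₁) * qTheta q (l₂ * b₂) * qTheta q (l₂ * b₃)) -
        l₁ / l₂ * (qTheta q (l₁ * b₁) * qTheta q (l₁ * b₂) * qTheta q (l₁ * b₃) *
          (qTheta q (l₂ / a₁) * qTheta q (l₂ / a₂) * qTheta q (l₂ / a₃))) := by
  set f : ℂ → ℂ := fun b => qTheta q (l₁ * b) * qTheta q (l₂ * b) * qTheta q (l₃ * b) with hf
  set κ := a₁ * a₂ with hκ
  have hκ0 : κ ≠ 0 := mul_ne_zero ha₁ ha₂
  set S : ℂ → ℂ := fun x => totalPoleSum q x (κ / x) a₃ b₁ b₂ b₃ f with hS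
  have hSd : DifferentiableOn ℂ S {0}ᶜ :=
    ((differentiableOn_poleSum hq hq0 κ a₃ _ hb₁ hb₂ hb₃ h₁₂ h₁₃).add
      (differentiableOn_poleSum hq hq0 κ a₃ _ hb₂ hb₁ hb₃ (ne_zpow_inv h₁₂) h₂₃)).add
      (differentiableOn_poleSum hq hq0 κ a₃ _ hb₃ hb₁ hb₂ (ne_zpow_inv h₁₃) (ne_zpow_inv h₂₃))
  have hpf := qTheta_partialFraction hq hq0 hb₁ hb₂ hb₃ hl₁ hl₂ hl₃
    (by linear_combination b₁ * b₂ * b₃ * hlam + q * hbal) h₁₂ h₁₃ h₂₃ hlb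
  -- The shift relation is applied to the pair (x, κ/(qx)), whose two shifts are (qx, κ/(qx)) and
  -- (x, κ/x). It fails to apply only where some 1 - xb_j or 1 - κb_j/(qx) is zero, and continuity
  -- covers these points.
  have hSq : ∀ x ≠ 0, S (q * x) = κ / q / x ^ 2 * S x := by
    refine eqOn_of_eqOn_diff_countable isOpen_compl_singleton
      (S := {b₁⁻¹, b₂⁻¹, b₃⁻¹, κ * b₁ / q, κ * b₂ / q, κ * b₃ / q})
      (Set.toFinite _).countable ?_ ?_ ?_
    · exact hSd.continuousOn.comp (by fun_prop) fun x hx => mul_ne_zero hq0 hx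
    · refine ContinuousOn.mul (continuousOn_const.div (by fun_prop) ?_) hSd.continuousOn
      exact fun x hx => pow_ne_zero _ hx
    · intro x hx hxS
      have hx : x ≠ 0 := hx
      simp only [Set.mem_insert_iff, Set.mem_singleton_iff, not_or] at hxS
      obtain ⟨x₁, x₂, x₃, x₄, x₅, x₆⟩ := hxS
      have n : ∀ {b : ℂ}, b ≠ 0 → x ≠ b⁻¹ → 1 - x * b ≠ 0 := fun hb h h0 =>
        h (eq_inv_of_mul_eq_one_left (sub_eq_zero.1 h0).symm)
      have n' : ∀ {b : ℂ}, x ≠ κ * b / q → 1 - κ / (q * x) * b ≠ 0 := fun h h0 => by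
        apply h
        field_simp at h0
        rw [eq_div_iff hq0]
        linear_combination h0
      have h := totalPoleSum_shift hq hq0 (a₂ := κ / (q * x)) (a₃ := a₃) f hx hb₁ hb₂ hb₃
        (by field_simp; rw [hκ]; linear_combination hbal) h₁₂ h₁₃ h₂₃ (n hb₁ x₁) (n hb₂ x₂)
        (n hb₃ x₃) (n' x₄) (n' x₅) (n' x₆) hpf
      have e : q * (κ / (q * x)) = κ / x := by field_simp
      rw [e] at h
      simp only [hS, h]
      field_simp
  -- The identity at x = 1/b₁, stated for arbitrary b's so that it can also be used with b₁ and b₂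
  -- exchanged. It is Weierstrass' relation with κb₁ in the role of a₂.
  have key : ∀ {b₁ b₂ b₃ : ℂ}, b₁ ≠ 0 → b₂ ≠ 0 → b₃ ≠ 0 → a₁ * a₂ * a₃ * b₁ * b₂ * b₃ = q →
      (∀ k : ℤ, b₁ / b₂ ≠ q ^ k) → (∀ k : ℤ, b₁ / b₃ ≠ q ^ k) →
      (∀ k : ℤ, κ * b₁ / l₂ ≠ q ^ k) →
      totalPoleSum q b₁⁻¹ (κ / b₁⁻¹) a₃ b₁ b₂ b₃ f * qTheta q (l₁ / l₂) =
        qTheta q (l₁ / b₁⁻¹) * qTheta q (b₁⁻¹ * (l₁ / κ)) * (qTheta q (l₁ / a₃) *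
          (qTheta q (l₂ * b₁) * qTheta q (l₂ * b₂) * qTheta q (l₂ * b₃))) -
        qTheta q (l₂ / b₁⁻¹) * qTheta q (b₁⁻¹ * (l₂ / κ)) *
          (l₁ / l₂ * (qTheta q (l₁ * b₁) * qTheta q (l₁ * b₂) * qTheta q (l₁ * b₃)) *
          qTheta q (l₂ / a₃)) := by
    intro b₁ b₂ b₃ hb₁ hb₂ hb₃ hbal h₁₂ h₁₃ g
    have hκb : κ * b₁ ≠ 0 := mul_ne_zero hκ0 hb₁
    have hbal' : κ * b₁ * a₃ * b₂ * b₃ = q := by rw [hκ]; linear_combination hbal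
    have hW := qTheta_weierstrass hq hq0 hl₁ hl₂ hκb ha₃ hb₂ hb₃ hbal' g hal
    have e : ∀ l : ℂ, b₁⁻¹ * (l / κ) = l / (κ * b₁) := fun l => by field_simp
    have e' : l₃ * b₁ = q / (l₁ * l₂ / (κ * b₁ * a₃)) := by
      rw [hκ]; field_simp; linear_combination hlam
    have e'' : qTheta q (l₃ * b₁) = qTheta q (l₁ * l₂ / (κ * b₁ * a₃)) := by
      rw [e', qTheta_q_div hq0 (by positivity)]
    rw [div_inv_eq_mul, div_inv_eq_mul, div_inv_eq_mul, e, e, totalPoleSum_inv hq hq0 f hκb hb₁ hb₂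
      hb₃ hbal' h₁₂ h₁₃]
    simp only [hf, e'']
    linear_combination (-(qTheta q (l₁ * b₁) * qTheta q (l₂ * b₁))) * hW
  have main := eq_zero_of_q_mul_eq_of_zeros hq hq0 (C := κ / q) (u := b₁⁻¹) (v := b₂⁻¹)
    (f := fun x => S x * qTheta q (l₁ / l₂) -
      (qTheta q (l₁ / x) * qTheta q (x * (l₁ / κ)) * (qTheta q (l₁ / a₃) *
          (qTheta q (l₂ * b₁) * qTheta q (l₂ * b₂) * qTheta q (l₂ * b₃))) -
        qTheta q (l₂ / x) * qTheta q (x * (l₂ / κ)) *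
          (l₁ / l₂ * (qTheta q (l₁ * b₁) * qTheta q (l₁ * b₂) * qTheta q (l₁ * b₃)) *
          qTheta q (l₂ / a₃))))
    ?_ (div_ne_zero hκ0 hq0) ?_ (inv_ne_zero hb₁) (inv_ne_zero hb₂) ?_ ?_ ?_ ?_ a₁ ha₁
  · have e₁ : κ / a₁ = a₂ := by rw [hκ]; field_simp
    have e₂ : ∀ l : ℂ, a₁ * (l / κ) = l / a₂ := fun l => by rw [hκ]; field_simp
    simp only [hS, e₁, e₂] at main
    linear_combination main
  · have d := @differentiableOn_qTheta_mul q hq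
    have d' := @differentiableOn_qTheta_const_div q hq
    exact (hSd.mul_const _).sub ((((d' hl₁).mul (d (div_ne_zero hl₁ hκ0))).mul_const _).sub
      (((d' hl₂).mul (d (div_ne_zero hl₂ hκ0))).mul_const _))
  · intro x hx
    have t : ∀ {l : ℂ}, l ≠ 0 → qTheta q (l / (q * x)) * qTheta q (q * x * (l / κ)) =
        κ / q / x ^ 2 * (qTheta q (l / x) * qTheta q (x * (l / κ))) := by
      intro l hl
      rw [qTheta_q_mul_mul hq hq0 hx (div_ne_zero hl hκ0), qTheta_div_q_mul hq hq0 hx hl]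
      generalize qTheta q (x * (l / κ)) = A
      field_simp
    simp only [t hl₁, t hl₂, hSq x hx]
    ring
  · simp only [hS]
    rw [sub_eq_zero]
    exact key hb₁ hb₂ hb₃ hbal h₁₂ h₁₃ g₁
  · simp only [hS]
    rw [sub_eq_zero, totalPoleSum_swap]
    have := key hb₂ hb₁ hb₃ (by linear_combination hbal) (ne_zpow_inv h₁₂) h₂₃ g₂
    linear_combination this
  · intro k hk
    refine h₁₂ k ?_
    rw [← hk]; field_simp
  · intro k hk
    -- By balancing, C/(uv) = κ b₁ b₂/q = 1/(a₃ b₃).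
    refine hab (-k) ?_
    rw [zpow_neg, ← hk, ← hbal, hκ]
    field_simp

end

/-! ### Contour integrals along piecewise C¹ paths -/

theorem contourIntegral_eq_integral_deriv (f : ℂ → ℂ) {p p' : ℂ} (γ : Path p p') :
    contourIntegral f γ = ∫ t in (0 : ℝ)..1, deriv γ.extend t * f (γ.extend t) := by
  rw [contourIntegral, curveIntegral_eq_intervalIntegral_deriv]
  simp [ContinuousLinearMap.toSpanSingleton_apply]

theorem exists_mem_Ioo_of_notMem_range {s : ℕ → ℝ} {t : ℝ} (ht : t ∉ Set.range s) :
    ∀ n, s 0 < t → t < s n → ∃ i < n, t ∈ Set.Ioo (s i) (s (i + 1))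
  | 0, h0, hn => absurd (h0.trans hn) (lt_irrefl _)
  | n + 1, h0, hn => by
    rcases lt_trichotomy t (s n) with h | h | h
    · obtain ⟨i, hi, hti⟩ := exists_mem_Ioo_of_notMem_range ht n h0 h
      exact ⟨i, hi.trans n.lt_succ_self, hti⟩
    · exact absurd ⟨n, h.symm⟩ ht
    · exact ⟨n, n.lt_succ_self, h, hn⟩

theorem Path.extend_mem_range' {p p' : ℂ} (γ : Path p p') (t : ℝ) :
    γ.extend t ∈ Set.range γ := by
  rw [← γ.extend_range]; exact ⟨t, rfl⟩

section

variable {p p' : ℂ} {γ : Path p p'} (hγ : IsPiecewiseC1 γ)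
include hγ

theorem IsPiecewiseC1.exists_countable_hasDerivAt :
    ∃ S : Set ℝ, S.Countable ∧
      ∀ t ∈ Set.Ioo (0 : ℝ) 1 \ S, HasDerivAt γ.extend (deriv γ.extend t) t := by
  obtain ⟨n, s, -, h0, h1, hs⟩ := hγ
  refine ⟨Set.range s, Set.countable_range s, fun t ⟨⟨ht0, ht1⟩, hts⟩ => ?_⟩
  obtain ⟨i, hi, hti⟩ := exists_mem_Ioo_of_notMem_range hts n (h0 ▸ ht0) (h1 ▸ ht1)
  exact (((hs i hi).differentiableOn one_ne_zero).differentiableAt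
    (Icc_mem_nhds hti.1 hti.2)).hasDerivAt

theorem IsPiecewiseC1.intervalIntegrable_deriv :
    IntervalIntegrable (deriv γ.extend) MeasureTheory.volume 0 1 := by
  obtain ⟨n, s, hmono, h0, h1, hs⟩ := hγ
  rw [← h0, ← h1]
  refine IntervalIntegrable.trans_iterate fun i hi => ?_
  -- A subdivision may repeat points; a degenerate piece contributes nothing.
  rcases (hmono i.le_succ).eq_or_lt with h | h
  · rw [Nat.succ_eq_add_one] at h; rw [h]
  · have hc := (hs i hi).continuousOn_derivWithin (uniqueDiffOn_Icc h) le_rfl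
    rw [← Set.uIcc_of_le h.le] at hc
    refine hc.intervalIntegrable.congr_uIoo fun t ht => ?_
    rw [Set.uIoo_of_le h.le] at ht
    rw [Set.uIcc_of_le h.le]
    exact derivWithin_of_mem_nhds (Icc_mem_nhds ht.1 ht.2)

theorem IsPiecewiseC1.intervalIntegrable_deriv_mul {f : ℂ → ℂ}
    (hf : ContinuousOn f (Set.range γ)) :
    IntervalIntegrable (fun t => deriv γ.extend t * f (γ.extend t)) MeasureTheory.volume 0 1 :=
  hγ.intervalIntegrable_deriv.mul_continuousOn
    (hf.comp γ.continuous_extend.continuousOn fun t _ => γ.extend_mem_range' t)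

omit hγ in
theorem contourIntegral_congr {f g : ℂ → ℂ} (h : Set.EqOn f g (Set.range γ)) :
    contourIntegral f γ = contourIntegral g γ := by
  rw [contourIntegral_eq_integral_deriv, contourIntegral_eq_integral_deriv]
  exact intervalIntegral.integral_congr fun t _ => by
    simp only [h (γ.extend_mem_range' t)]

theorem contourIntegral_add {f g : ℂ → ℂ} (hf : ContinuousOn f (Set.range γ))
    (hg : ContinuousOn g (Set.range γ)) :
    contourIntegral (fun z => f z + g z) γ = contourIntegral f γ + contourIntegral g γ := by
  simp only [contourIntegral_eq_integral_deriv, mul_add]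
  exact intervalIntegral.integral_add (hγ.intervalIntegrable_deriv_mul hf)
    (hγ.intervalIntegrable_deriv_mul hg)

omit hγ in
theorem contourIntegral_const_mul (c : ℂ) (f : ℂ → ℂ) :
    contourIntegral (fun z => c * f z) γ = c * contourIntegral f γ := by
  simp only [contourIntegral_eq_integral_deriv]
  rw [← intervalIntegral.integral_const_mul]
  congr 1; ext t; ring

theorem contourIntegral_sum {ι : Type*} (s : Finset ι) {f : ι → ℂ → ℂ}
    (hf : ∀ i ∈ s, ContinuousOn (f i) (Set.range γ)) :
    contourIntegral (fun z => ∑ i ∈ s, f i z) γ = ∑ i ∈ s, contourIntegral (f i) γ := by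
  simp only [contourIntegral_eq_integral_deriv, Finset.mul_sum]
  exact intervalIntegral.integral_finsetSum fun i hi => hγ.intervalIntegrable_deriv_mul (hf i hi)

theorem tendsto_contourIntegral {ι : Type*} {l : Filter ι} [l.IsCountablyGenerated]
    {F : ι → ℂ → ℂ} {f : ℂ → ℂ} {C : ℝ} (hF : ∀ᶠ n in l, ContinuousOn (F n) (Set.range γ))
    (hC : ∀ᶠ n in l, ∀ z ∈ Set.range γ, ‖F n z‖ ≤ C)
    (hlim : ∀ z ∈ Set.range γ, Tendsto (fun n => F n z) l (𝓝 (f z))) :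
    Tendsto (fun n => contourIntegral (F n) γ) l (𝓝 (contourIntegral f γ)) := by
  simp only [contourIntegral_eq_integral_deriv]
  refine intervalIntegral.tendsto_integral_filter_of_dominated_convergence
    (fun t => ‖deriv γ.extend t‖ * C) ?_ ?_ (hγ.intervalIntegrable_deriv.norm.mul_const C) ?_
  · filter_upwards [hF] with n hn
    exact (hγ.intervalIntegrable_deriv_mul hn).def'.aestronglyMeasurable
  · filter_upwards [hC] with n hn
    refine Eventually.of_forall fun t _ => ?_
    rw [norm_mul]
    exact mul_le_mul_of_nonneg_left (hn _ (γ.extend_mem_range' t)) (norm_nonneg _)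
  · exact Eventually.of_forall fun t _ => (hlim _ (γ.extend_mem_range' t)).const_mul _

end

section

variable {p : ℂ} {γ : Path p p} (hγ : IsPiecewiseC1 γ)
include hγ

/-- The integral of an exact form along a closed path vanishes. -/
theorem contourIntegral_eq_zero_of_hasDerivAt {F f : ℂ → ℂ}
    (hF : ∀ z ∈ Set.range γ, HasDerivAt F (f z) z) (hf : ContinuousOn f (Set.range γ)) :
    contourIntegral f γ = 0 := by
  obtain ⟨S, hS, hd⟩ := hγ.exists_countable_hasDerivAt
  rw [contourIntegral_eq_integral_deriv]
  have hFc : ContinuousOn F (Set.range γ) := fun z hz => (hF z hz).continuousAt.continuousWithinAt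
  rw [MeasureTheory.integral_eq_of_hasDerivAt_off_countable_of_le (fun t => F (γ.extend t))
    (fun t => deriv γ.extend t * f (γ.extend t)) zero_le_one hS
    (hFc.comp γ.continuous_extend.continuousOn fun t _ => γ.extend_mem_range' t) (fun t ht => ?_)
    (hγ.intervalIntegrable_deriv_mul hf)]
  · simp
  · rw [mul_comm]
    exact HasDerivAt.comp t (hF _ (γ.extend_mem_range' t)) (hd t ht)

theorem contourIntegral_polynomial (P : Polynomial ℂ) :
    contourIntegral (fun z => P.eval z) γ = 0 := by
  have h : contourIntegral (fun z => P.eval z) γ =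
      ∑ i ∈ P.support, P.coeff i * contourIntegral (fun z => z ^ i) γ := by
    simp only [Polynomial.eval_eq_sum, Polynomial.sum, ← contourIntegral_const_mul]
    exact contourIntegral_sum hγ _ fun i _ => by fun_prop
  rw [h]
  refine Finset.sum_eq_zero fun i _ => ?_
  rw [contourIntegral_eq_zero_of_hasDerivAt hγ (F := fun z => z ^ (i + 1) / (i + 1)) _ (by fun_prop),
    mul_zero]
  intro z _
  refine ((hasDerivAt_pow (i + 1) z).div_const ((i : ℂ) + 1)).congr_deriv ?_
  have : (i : ℂ) + 1 ≠ 0 := Nat.cast_add_one_ne_zero i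
  push_cast
  field_simp

theorem contourIntegral_inv_pow {w : ℂ} (hw : w ∉ Set.range γ) {m : ℕ} (hm : 2 ≤ m) :
    contourIntegral (fun z => ((z - w) ^ m)⁻¹) γ = 0 := by
  obtain ⟨n, rfl⟩ : ∃ n, m = n + 2 := ⟨m - 2, by lia⟩
  have hne : ∀ z ∈ Set.range γ, z - w ≠ 0 := fun z hz h => hw (sub_eq_zero.1 h ▸ hz)
  have hn : (n : ℂ) + 1 ≠ 0 := Nat.cast_add_one_ne_zero n
  refine contourIntegral_eq_zero_of_hasDerivAt hγ
    (F := fun z => -((((n : ℂ) + 1)⁻¹) * ((z - w) ^ (n + 1))⁻¹)) (fun z hz => ?_) ?_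
  · have h1 := (((hasDerivAt_id z).sub_const w).pow (n + 1)).inv (pow_ne_zero _ (hne z hz))
    refine ((h1.const_mul (((n : ℂ) + 1)⁻¹)).neg).congr_deriv ?_
    have := hne z hz
    simp only [id, Pi.pow_apply]
    push_cast
    field_simp
    ring_nf
  · exact ContinuousOn.inv₀ (by fun_prop) fun z hz => pow_ne_zero _ (hne z hz)

omit hγ in
theorem contourIntegral_inv {w : ℂ} :
    contourIntegral (fun z => (z - w)⁻¹) γ = 2 * Real.pi * Complex.I * windingNumber γ w := by
  rw [windingNumber, mul_inv_cancel_left₀]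
  simp [Real.pi_ne_zero]

end

/-! ### The residue theorem for rational functions -/

section

variable {p : ℂ} {γ : Path p p} (hγ : IsPiecewiseC1 γ)
include hγ

omit hγ in
theorem prod_map_sub_ne_zero {O : Multiset ℂ} (hO : ∀ o ∈ O, o ∉ Set.range γ) {z : ℂ}
    (hz : z ∈ Set.range γ) : (O.map (z - ·)).prod ≠ 0 := by
  rw [Ne, Multiset.prod_eq_zero_iff, Multiset.mem_map]
  rintro ⟨o, ho, h⟩
  exact hO o ho (sub_eq_zero.1 h ▸ hz)

omit hγ in
theorem continuous_prod_map_sub (O : Multiset ℂ) : Continuous fun z => (O.map (z - ·)).prod := by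
  induction O using Multiset.induction_on with
  | empty => simpa using continuous_const
  | cons o O ih =>
    simp only [Multiset.map_cons, Multiset.prod_cons]
    exact (continuous_id.sub continuous_const).mul ih

omit hγ in
theorem continuousOn_polynomial_div {O : Multiset ℂ} (hO : ∀ o ∈ O, o ∉ Set.range γ)
    (P : Polynomial ℂ) :
    ContinuousOn (fun z => P.eval z / (O.map (z - ·)).prod) (Set.range γ) :=
  P.continuous.continuousOn.div (continuous_prod_map_sub O).continuousOn
    fun _ hz => prod_map_sub_ne_zero hO hz

/-- The integral of a rational function along a path that does not wind around its poles. -/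
theorem contourIntegral_polynomial_div_eq_zero (n : ℕ) : ∀ (O : Multiset ℂ), O.card = n →
    (∀ o ∈ O, o ∉ Set.range γ) → (∀ o ∈ O, windingNumber γ o = 0) → ∀ P : Polynomial ℂ,
    contourIntegral (fun z => P.eval z / (O.map (z - ·)).prod) γ = 0 := by
  induction n with
  | zero =>
    intro O hO _ _ P
    rw [Multiset.card_eq_zero] at hO
    subst hO
    simpa using contourIntegral_polynomial hγ P
  | succ n ih =>
    intro O hcard hO hw P
    obtain ⟨o, ho⟩ := Multiset.card_pos_iff_exists_mem.1 (by rw [hcard]; exact n.succ_pos)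
    have hmem : ∀ o' : ℂ, ∀ x ∈ O.erase o', x ∈ O := fun o' x hx => Multiset.mem_of_mem_erase hx
    have herase : ∀ o' ∈ O, ∀ z, (O.map (z - ·)).prod =
        (z - o') * ((O.erase o').map (z - ·)).prod := by
      intro o' ho' z
      rw [← Multiset.prod_cons, ← Multiset.map_cons (z - ·), Multiset.cons_erase ho']
    have hIH : ∀ o' ∈ O, ∀ P : Polynomial ℂ,
        contourIntegral (fun z => P.eval z / ((O.erase o').map (z - ·)).prod) γ = 0 :=
      fun o' ho' => ih (O.erase o') (by rw [Multiset.card_erase_of_mem ho', hcard]; rfl)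
        (fun x hx => hO x (hmem o' x hx)) (fun x hx => hw x (hmem o' x hx))
    -- With a single repeated pole, division with remainder leaves a constant over (z - o)^(n+1):
    -- exact for n ≥ 1, and a winding number for n = 0. With two distinct poles, 1/((z-o)(z-o'))
    -- splits and each part has one pole fewer. A multiset is used because outer poles may coincide,
    -- the ratios a_i/a_j being unrestricted.
    by_cases hall : ∀ o' ∈ O, o' = o
    · have hrep := Multiset.eq_replicate.2 ⟨hcard, hall⟩
      have hz : ∀ z ∈ Set.range γ, z - o ≠ 0 := fun z hz h => hO o ho (sub_eq_zero.1 h ▸ hz)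
      have e : Set.EqOn (fun z => P.eval z / (O.map (z - ·)).prod)
          (fun z => (P /ₘ (Polynomial.X - Polynomial.C o)).eval z /
            ((O.erase o).map (z - ·)).prod + P.eval o * ((z - o) ^ (n + 1))⁻¹) (Set.range γ) := by
        intro z hzr
        have h1 := congrArg (Polynomial.eval z)
          (Polynomial.modByMonic_add_div P (Polynomial.X - Polynomial.C o))
        rw [Polynomial.modByMonic_X_sub_C_eq_C_eval] at h1
        simp only [Polynomial.eval_add, Polynomial.eval_mul, Polynomial.eval_sub,
          Polynomial.eval_X, Polynomial.eval_C] at h1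
        have h2 := hz z hzr
        have h3 : (O.map (z - ·)).prod = (z - o) ^ (n + 1) := by
          rw [hrep, Multiset.map_replicate, Multiset.prod_replicate]
        have h4 := herase o ho z
        have h5 := prod_map_sub_ne_zero (fun x hx => hO x (hmem o x hx)) hzr
        simp only
        rw [← h3, h4]
        field_simp
        rw [← h1]; ring
      rw [contourIntegral_congr e, contourIntegral_add hγ
        (continuousOn_polynomial_div (fun x hx => hO x (hmem o x hx)) _) ?_, hIH o ho, zero_add,
        contourIntegral_const_mul]
      · rcases Nat.eq_zero_or_pos n with rfl | hn
        · simp only [zero_add, pow_one]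
          rw [contourIntegral_inv, hw o ho]; ring
        · rw [contourIntegral_inv_pow hγ (hO o ho) (by lia), mul_zero]
      · exact continuousOn_const.mul
          (ContinuousOn.inv₀ (by fun_prop) fun z hzr => pow_ne_zero _ (hz z hzr))
    · push Not at hall
      obtain ⟨o', ho', hne⟩ := hall
      have e : Set.EqOn (fun z => P.eval z / (O.map (z - ·)).prod)
          (fun z => (o - o')⁻¹ * (P.eval z / ((O.erase o').map (z - ·)).prod) +
            (-(o - o')⁻¹) * (P.eval z / ((O.erase o).map (z - ·)).prod)) (Set.range γ) := by
        intro z hzr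
        have h0 := prod_map_sub_ne_zero hO hzr
        have h1 := herase o ho z
        have h2 := herase o' ho' z
        have h3 := prod_map_sub_ne_zero (fun x hx => hO x (hmem o x hx)) hzr
        have h4 := prod_map_sub_ne_zero (fun x hx => hO x (hmem o' x hx)) hzr
        have h5 : o - o' ≠ 0 := sub_ne_zero.2 hne.symm
        simp only
        have e1 : P.eval z / ((O.erase o').map (z - ·)).prod =
            P.eval z * (z - o') / (O.map (z - ·)).prod := by
          rw [div_eq_div_iff h4 h0, h2]; ring
        have e2 : P.eval z / ((O.erase o).map (z - ·)).prod =
            P.eval z * (z - o) / (O.map (z - ·)).prod := by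
          rw [div_eq_div_iff h3 h0, h1]; ring
        rw [e1, e2]
        field_simp
        ring
      rw [contourIntegral_congr e, contourIntegral_add hγ, contourIntegral_const_mul,
        contourIntegral_const_mul, hIH o ho, hIH o' ho', mul_zero, mul_zero, add_zero]
      · exact continuousOn_const.mul
          (continuousOn_polynomial_div (fun x hx => hO x (hmem o' x hx)) _)
      · exact continuousOn_const.mul
          (continuousOn_polynomial_div (fun x hx => hO x (hmem o x hx)) _)

/-- The residue theorem for a rational function whose poles inside the path are simple. -/
theorem contourIntegral_rational {ι : Type*} [Fintype ι] [DecidableEq ι] {s : ι → ℂ}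
    (hs : Function.Injective s) (hsγ : ∀ i, s i ∉ Set.range γ) (hsw : ∀ i, windingNumber γ (s i) = 1)
    {O : Multiset ℂ} (hO : ∀ o ∈ O, o ∉ Set.range γ) (hOw : ∀ o ∈ O, windingNumber γ o = 0)
    (P : Polynomial ℂ) :
    (2 * Real.pi * Complex.I)⁻¹ *
        contourIntegral (fun z => P.eval z / ((∏ i, (z - s i)) * (O.map (z - ·)).prod)) γ =
      ∑ i, P.eval (s i) / ((∏ j ∈ Finset.univ.erase i, (s i - s j)) *
        (O.map (s i - ·)).prod) := by
  classical
  set c : ι → ℂ := fun i => P.eval (s i) / ((∏ j ∈ Finset.univ.erase i, (s i - s j)) *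
        (O.map (s i - ·)).prod) with hc
  set Q : Polynomial ℂ := (O.map fun o => Polynomial.X - Polynomial.C o).prod with hQ
  have hQe : ∀ z, Q.eval z = (O.map (z - ·)).prod := by
    intro z
    rw [hQ, Polynomial.eval_multiset_prod, Multiset.map_map]
    simp
  -- `M` is the numerator left after subtracting the expected principal parts. It vanishes at every
  -- `s i`, hence is divisible by ∏ (X - s i), and the quotient leaves a function with outer poles
  -- only.
  set M : Polynomial ℂ := P - ∑ i, Polynomial.C (c i) *
    ((∏ j ∈ Finset.univ.erase i, (Polynomial.X - Polynomial.C (s j))) * Q) with hM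
  have hMe : ∀ z, M.eval z = P.eval z - ∑ i, c i *
      ((∏ j ∈ Finset.univ.erase i, (z - s j)) * (O.map (z - ·)).prod) := by
    intro z
    simp [hM, Polynomial.eval_finsetSum, Polynomial.eval_prod, hQe]
  have hM0 : ∀ i, M.eval (s i) = 0 := by
    intro i
    rw [hMe, Finset.sum_eq_single i]
    · rw [hc, div_mul_cancel₀, sub_self]
      refine mul_ne_zero (Finset.prod_ne_zero_iff.2 fun j hj => ?_) ?_
      · exact sub_ne_zero.2 (hs.ne (Finset.ne_of_mem_erase hj).symm)
      · rw [Ne, Multiset.prod_eq_zero_iff, Multiset.mem_map]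
        rintro ⟨o, ho, h⟩
        have := hOw o ho
        rw [← sub_eq_zero.1 h, hsw] at this
        exact one_ne_zero this
    · intro j _ hj
      rw [Finset.prod_eq_zero (Finset.mem_erase.2 ⟨hj.symm, Finset.mem_univ i⟩) (sub_self _)]
      ring
    · simp
  obtain ⟨R, hR⟩ : (∏ i, (Polynomial.X - Polynomial.C (s i))) ∣ M :=
    Finset.prod_dvd_of_coprime ((Polynomial.pairwise_coprime_X_sub_C hs).set_pairwise _)
      fun i _ => Polynomial.dvd_iff_isRoot.2 (hM0 i)
  have hne : ∀ i, ∀ z ∈ Set.range γ, z - s i ≠ 0 := fun i z hz h =>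
    hsγ i (sub_eq_zero.1 h ▸ hz)
  have e : Set.EqOn (fun z => P.eval z / ((∏ i, (z - s i)) * (O.map (z - ·)).prod))
      (fun z => ∑ i, c i * (z - s i)⁻¹ + R.eval z / (O.map (z - ·)).prod) (Set.range γ) := by
    intro z hz
    have h1 := prod_map_sub_ne_zero hO hz
    have h2 : ∏ i, (z - s i) ≠ 0 := Finset.prod_ne_zero_iff.2 fun i _ => hne i z hz
    have h3 := hMe z
    rw [hR, Polynomial.eval_mul, Polynomial.eval_prod] at h3
    simp only [Polynomial.eval_sub, Polynomial.eval_X, Polynomial.eval_C] at h3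
    have h4 : ∀ i, c i * (z - s i)⁻¹ = c i * ((∏ j ∈ Finset.univ.erase i, (z - s j)) *
        (O.map (z - ·)).prod) / ((∏ i, (z - s i)) * (O.map (z - ·)).prod) := by
      intro i
      have h5 := hne i z hz
      rw [← Finset.mul_prod_erase _ _ (Finset.mem_univ i)] at h2 ⊢
      have h6 := right_ne_zero_of_mul h2
      field_simp
    simp only [h4, ← Finset.sum_div]
    generalize ∑ i, c i * ((∏ j ∈ Finset.univ.erase i, (z - s j)) * (O.map (z - ·)).prod) = T at h3 ⊢
    field_simp
    linear_combination -h3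
  rw [contourIntegral_congr e, contourIntegral_add hγ ?_ (continuousOn_polynomial_div hO R),
    contourIntegral_polynomial_div_eq_zero hγ _ O rfl hO hOw, add_zero, contourIntegral_sum hγ,
    Finset.mul_sum]
  · refine Finset.sum_congr rfl fun i _ => ?_
    rw [contourIntegral_const_mul, contourIntegral_inv, hsw]
    have : (2 * Real.pi * Complex.I : ℂ) ≠ 0 := Complex.two_pi_I_ne_zero
    field_simp
  · exact fun i _ => continuousOn_const.mul (ContinuousOn.inv₀ (by fun_prop) (hne i))
  · exact continuousOn_finsetSum _ fun i _ =>
      continuousOn_const.mul (ContinuousOn.inv₀ (by fun_prop) (hne i))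

end

/-! ### The truncated integrand and its residues -/

/-- The integrand with all infinite products truncated after `N` factors. -/
noncomputable def truncIntegrand (q : ℂ) (a b lam : Fin 3 → ℂ) (N : ℕ) (z : ℂ) : ℂ :=
  (∏ j, qPoch q (lam j * z) N * qPoch q (q / (lam j * z)) N /
    (qPoch q (a j * z) N * qPoch q (b j / z) N)) / z

/-- The residue of the truncated integrand at `b j * q ^ k`. -/
noncomputable def truncResidue (q : ℂ) (a b lam : Fin 3 → ℂ) (N : ℕ) (j : Fin 3) (k : ℕ) : ℂ :=
  (∏ i, qPoch q (lam i * (b j * q ^ k)) N * qPoch q (q / (lam i * (b j * q ^ k))) N /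
    qPoch q (a i * (b j * q ^ k)) N) /
  ∏ l, if l = j then ∏ m ∈ Finset.range N, (if m = k then 1 else 1 - q ^ m / q ^ k)
    else qPoch q (b l / (b j * q ^ k)) N

theorem qPoch_div_eq_prod {q : ℂ} (b : ℂ) {z : ℂ} (hz : z ≠ 0) (N : ℕ) :
    ∏ k : Fin N, (z - b * q ^ (k : ℕ)) = z ^ N * qPoch q (b / z) N := by
  rw [Fin.prod_univ_eq_prod_range fun k => z - b * q ^ k, qPoch]
  have h : z ^ N = ∏ _k ∈ Finset.range N, z := by simp
  rw [h, ← Finset.prod_mul_distrib]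
  exact Finset.prod_congr rfl fun k _ => by field_simp

section

variable {q : ℂ} (hq : ‖q‖ < 1) (hq0 : q ≠ 0)
include hq hq0

omit hq in
-- The left side is the polynomial numerator over the outer poles. The power z^(3N) comes from
-- clearing z in q/(λ_j z), and is later cancelled by the same power from the factors 1 - b_j q^k/z.
theorem prod_truncated {a : Fin 3 → ℂ} (lam : Fin 3 → ℂ) (ha : ∀ j, a j ≠ 0)
    (N : ℕ) {z : ℂ} (hz : z ≠ 0) :
    (∏ x : Fin 3 × Fin N, ((1 - lam x.1 * q ^ (x.2 : ℕ) * z) *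
        (z - q / lam x.1 * q ^ (x.2 : ℕ)) * (-(a x.1 * q ^ (x.2 : ℕ)))⁻¹)) /
      ∏ x : Fin 3 × Fin N, (z - (a x.1)⁻¹ * (q ^ (x.2 : ℕ))⁻¹) =
    z ^ (3 * N) * ∏ j, (qPoch q (lam j * z) N * qPoch q (q / (lam j * z)) N /
      qPoch q (a j * z) N) := by
  rw [← Finset.prod_div_distrib, Fintype.prod_prod_type]
  have h : ∀ j : Fin 3, ∏ k : Fin N, ((1 - lam j * q ^ (k : ℕ) * z) *
        (z - q / lam j * q ^ (k : ℕ)) * (-(a j * q ^ (k : ℕ)))⁻¹) /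
        (z - (a j)⁻¹ * (q ^ (k : ℕ))⁻¹) =
      z ^ N * (qPoch q (lam j * z) N * qPoch q (q / (lam j * z)) N / qPoch q (a j * z) N) := by
    intro j
    have e : ∀ k : Fin N, ((1 - lam j * q ^ (k : ℕ) * z) *
        (z - q / lam j * q ^ (k : ℕ)) * (-(a j * q ^ (k : ℕ)))⁻¹) /
        (z - (a j)⁻¹ * (q ^ (k : ℕ))⁻¹) = (1 - lam j * z * q ^ (k : ℕ)) *
        (z - q / lam j * q ^ (k : ℕ)) / (1 - a j * z * q ^ (k : ℕ)) := by
      intro k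
      have h1 : 1 - a j * z * q ^ (k : ℕ) =
          -(a j * q ^ (k : ℕ)) * (z - (a j)⁻¹ * (q ^ (k : ℕ))⁻¹) := by
        have := ha j
        field_simp
        ring
      rw [h1, div_mul_eq_div_div]
      congr 1
      rw [div_eq_mul_inv]
      ring
    simp only [e]
    rw [Finset.prod_div_distrib, Finset.prod_mul_distrib, qPoch_div_eq_prod _ hz, div_div,
      Fin.prod_univ_eq_prod_range fun k => 1 - lam j * z * q ^ k,
      Fin.prod_univ_eq_prod_range fun k => 1 - a j * z * q ^ k]
    simp only [qPoch]
    ring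
  simp only [h]
  rw [Finset.prod_mul_distrib]
  simp only [Finset.prod_const, Finset.card_univ, Fintype.card_fin]
  ring

theorem pow_injective_of_norm_lt_one : Function.Injective fun k : ℕ => q ^ k := by
  intro m n h
  have h' : ‖q‖ ^ m = ‖q‖ ^ n := by rw [← norm_pow, ← norm_pow]; exact congrArg norm h
  exact pow_right_injective₀ (norm_pos_iff.2 hq0) hq.ne h'

omit hq in
-- The index `none` is the pole 0. Its factor z, together with the N - 1 remaining factors of the
-- j-th sequence, supplies the full power z^N for l = j.
theorem prod_erase_some {b : Fin 3 → ℂ} {N : ℕ} {j : Fin 3} {k : Fin N}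
    {z : ℂ} (hz : z ≠ 0) (hzb : z = b j * q ^ (k : ℕ)) :
    ∏ x ∈ (Finset.univ : Finset (Option (Fin 3 × Fin N))).erase (some (j, k)),
        (z - x.elim 0 fun x => b x.1 * q ^ (x.2 : ℕ)) =
      z ^ (3 * N) * ∏ l, if l = j then
          ∏ m ∈ Finset.range N, (if m = (k : ℕ) then 1 else 1 - q ^ m / q ^ (k : ℕ))
        else qPoch q (b l / z) N := by
  have h1 : ∏ x ∈ (Finset.univ : Finset (Option (Fin 3 × Fin N))).erase (some (j, k)),
      (z - x.elim 0 fun x => b x.1 * q ^ (x.2 : ℕ)) =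
      ∏ x : Option (Fin 3 × Fin N), if x = some (j, k) then 1 else
        (z - x.elim 0 fun x => b x.1 * q ^ (x.2 : ℕ)) := by
    rw [← Finset.prod_erase (a := some (j, k)) Finset.univ (by simp)]
    exact Finset.prod_congr rfl fun x hx => by rw [if_neg (Finset.ne_of_mem_erase hx)]
  have h2 : z = ∏ l : Fin 3, if l = j then z else 1 := by simp
  rw [h1, Fintype.prod_option, Fintype.prod_prod_type]
  simp only [Option.elim, sub_zero, reduceCtorEq, if_false, Option.some.injEq, Prod.mk.injEq]
  nth_rewrite 1 [h2]
  have h3 : z ^ (3 * N) = ∏ _l : Fin 3, z ^ N := by simp [← pow_mul, mul_comm]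
  rw [h3, ← Finset.prod_mul_distrib, ← Finset.prod_mul_distrib]
  refine Finset.prod_congr rfl fun l _ => ?_
  by_cases hl : l = j
  · subst hl
    have h4 : z = ∏ m : Fin N, if m = k then z else 1 := by simp
    have h5 : z ^ N = ∏ _m ∈ Finset.range N, z := by simp
    simp only [true_and, if_true]
    nth_rewrite 1 [h4]
    rw [h5, ← Finset.prod_mul_distrib, ← Finset.prod_mul_distrib, ← Fin.prod_univ_eq_prod_range
      fun m => z * if m = (k : ℕ) then 1 else 1 - q ^ m / q ^ (k : ℕ)]
    refine Finset.prod_congr rfl fun m _ => ?_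
    by_cases hm : m = k
    · simp [hm]
    · rw [if_neg hm, if_neg hm, if_neg (fun h => hm (Fin.ext h)), hzb]
      field_simp
  · simp only [hl, false_and, if_false, one_mul]
    exact qPoch_div_eq_prod _ hz N

theorem contourIntegral_truncIntegrand {a b lam : Fin 3 → ℂ} (ha : ∀ j, a j ≠ 0)
    (hb : ∀ j, b j ≠ 0) (hl : ∀ j, lam j ≠ 0) (hbal : (∏ j, lam j) * ∏ j, b j = q ^ 2)
    (hbb : ∀ i j, i ≠ j → ∀ k : ℤ, b i / b j ≠ q ^ k)
    {p : ℂ} {γ : Path p p} (hγ : IsSeparatingContour q a b γ) (N : ℕ) :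
    (2 * Real.pi * Complex.I)⁻¹ * contourIntegral (truncIntegrand q a b lam N) γ =
      q ^ N + ∑ j, ∑ k ∈ Finset.range N, truncResidue q a b lam N j k := by
  have hz : ∀ z ∈ Set.range γ, z ≠ 0 := by rintro _ ⟨t, rfl⟩; exact hγ.ne_zero t
  set s : Option (Fin 3 × Fin N) → ℂ := fun x => x.elim 0 fun x => b x.1 * q ^ (x.2 : ℕ) with hs
  set O : Multiset ℂ := (Finset.univ : Finset (Fin 3 × Fin N)).val.map
    fun x => (a x.1)⁻¹ * (q ^ (x.2 : ℕ))⁻¹ with hO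
  set P : Polynomial ℂ := ∏ x : Fin 3 × Fin N,
    ((1 - Polynomial.C (lam x.1 * q ^ (x.2 : ℕ)) * Polynomial.X) *
      (Polynomial.X - Polynomial.C (q / lam x.1 * q ^ (x.2 : ℕ))) *
      Polynomial.C (-(a x.1 * q ^ (x.2 : ℕ)))⁻¹) with hP
  have hPe : ∀ z, P.eval z = ∏ x : Fin 3 × Fin N, ((1 - lam x.1 * q ^ (x.2 : ℕ) * z) *
        (z - q / lam x.1 * q ^ (x.2 : ℕ)) * (-(a x.1 * q ^ (x.2 : ℕ)))⁻¹) := by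
    intro z
    rw [hP, Polynomial.eval_prod]
    simp only [Polynomial.eval_mul, Polynomial.eval_sub, Polynomial.eval_one, Polynomial.eval_C,
      Polynomial.eval_X]
  have hOe : ∀ z, (O.map (z - ·)).prod =
      ∏ x : Fin 3 × Fin N, (z - (a x.1)⁻¹ * (q ^ (x.2 : ℕ))⁻¹) := by
    intro z
    rw [hO, Multiset.map_map]
    rfl
  have hs_inj : Function.Injective s := by
    rintro (_ | ⟨j, k⟩) (_ | ⟨j', k'⟩) h
    · rfl
    · exact absurd h.symm (mul_ne_zero (hb j') (pow_ne_zero _ hq0))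
    · exact absurd h (mul_ne_zero (hb j) (pow_ne_zero _ hq0))
    · have h : b j * q ^ (k : ℕ) = b j' * q ^ (k' : ℕ) := h
      have hjj : j = j' := by
        by_contra hne
        refine hbb j j' hne ((k' : ℕ) - (k : ℕ)) ?_
        rw [zpow_sub₀ hq0, zpow_natCast, zpow_natCast,
          div_eq_div_iff (hb j') (pow_ne_zero _ hq0), h, mul_comm]
      subst hjj
      have := pow_injective_of_norm_lt_one hq hq0 (mul_left_cancel₀ (hb j) h)
      rw [Fin.ext this]
  have hsγ : ∀ x, s x ∉ Set.range γ := by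
    rintro (_ | ⟨j, k⟩) ⟨t, ht⟩
    · exact hγ.ne_zero t ht
    · exact hγ.ne_inner j k t ht
  have hsw : ∀ x, windingNumber γ (s x) = 1 := by
    rintro (_ | ⟨j, k⟩)
    · exact hγ.winding_zero
    · exact hγ.winding_inner j k
  have hOγ : ∀ o ∈ O, o ∉ Set.range γ := by
    intro o ho
    obtain ⟨x, -, rfl⟩ := Multiset.mem_map.1 ho
    rintro ⟨t, ht⟩
    exact hγ.ne_outer _ _ t ht
  have hOw : ∀ o ∈ O, windingNumber γ o = 0 := by
    intro o ho
    obtain ⟨x, -, rfl⟩ := Multiset.mem_map.1 ho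
    exact hγ.winding_outer _ _
  have main := contourIntegral_rational hγ.piecewiseC1 hs_inj hsγ hsw hOγ hOw P
  have e : Set.EqOn (truncIntegrand q a b lam N)
      (fun z => P.eval z / ((∏ i, (z - s i)) * (O.map (z - ·)).prod)) (Set.range γ) := by
    intro z hzr
    have hz0 := hz z hzr
    simp only [truncIntegrand]
    rw [mul_comm (∏ i, (z - s i)), ← div_div, hPe, hOe, prod_truncated hq0 lam ha N hz0,
      Fintype.prod_option, Fintype.prod_prod_type]
    simp only [hs, Option.elim, sub_zero, qPoch_div_eq_prod _ hz0]
    rw [Finset.prod_mul_distrib, Finset.prod_const, Finset.card_univ, Fintype.card_fin, ← pow_mul,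
      mul_comm N 3]
    simp only [← div_div (_ * _) (qPoch q (a _ * z) N)]
    rw [Finset.prod_div_distrib (g := fun j => qPoch q (b j / z) N)]
    have := pow_ne_zero (3 * N) hz0
    rw [mul_left_comm, mul_div_mul_left _ _ this, mul_comm z, div_div]
  rw [contourIntegral_congr e, main, Fintype.sum_option, Fintype.sum_prod_type]
  congr 1
  · have e1 : ∀ i : Fin 3 × Fin N, s none - s (some i) = -(b i.1 * q ^ (i.2 : ℕ)) := fun i => by
      simp [hs]
    have e2 : (Finset.univ : Finset (Option (Fin 3 × Fin N))).erase none =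
        Finset.univ.map Function.Embedding.some := by
      ext x; cases x <;> simp
    rw [e2, Finset.prod_map, hPe, hOe]
    simp only [Function.Embedding.some_apply, e1]
    simp only [hs, Option.elim, mul_zero, sub_zero, one_mul, zero_sub]
    rw [← Finset.prod_mul_distrib, ← Finset.prod_div_distrib, Fintype.prod_prod_type]
    -- Residue at 0: each pair (j, k) contributes q/(λ_j b_j). By balancing the product over j is
    -- q³/q² = q, so the total is q^N.
    have e3 : ∀ (j : Fin 3) (k : Fin N), -(q / lam j * q ^ (k : ℕ)) * (-(a j * q ^ (k : ℕ)))⁻¹ /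
        (-(b j * q ^ (k : ℕ)) * -((a j)⁻¹ * (q ^ (k : ℕ))⁻¹)) = q / (lam j * b j) := by
      intro j k
      have := ha j
      have := hb j
      have := hl j
      field_simp
    simp only [e3, Finset.prod_const, Finset.card_univ, Fintype.card_fin]
    rw [Finset.prod_pow, Finset.prod_div_distrib, Finset.prod_mul_distrib, hbal]
    simp only [Finset.prod_const, Finset.card_univ, Fintype.card_fin]
    congr 1
    field_simp
  · refine Finset.sum_congr rfl fun j _ => ?_
    rw [← Fin.sum_univ_eq_sum_range]
    refine Finset.sum_congr rfl fun k _ => ?_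
    have hz0 : b j * q ^ (k : ℕ) ≠ 0 := mul_ne_zero (hb j) (pow_ne_zero _ hq0)
    have hsjk : s (some (j, k)) = b j * q ^ (k : ℕ) := rfl
    rw [mul_comm (∏ i ∈ _, _), ← div_div, hPe, hOe, hsjk, prod_truncated hq0 lam ha N hz0,
      truncResidue]
    rw [prod_erase_some hq0 hz0 rfl,
      mul_div_mul_left _ _ (pow_ne_zero (3 * N) hz0)]

end

/-! ### Uniform bounds and limits of the residues -/

theorem exists_bound_mul {f g : ℕ → ℕ → ℂ} (hf : ∃ C, ∀ N k, ‖f N k‖ ≤ C)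
    (hg : ∃ C, ∀ N k, ‖g N k‖ ≤ C) : ∃ C, ∀ N k, ‖f N k * g N k‖ ≤ C := by
  obtain ⟨C, hC⟩ := hf
  obtain ⟨D, hD⟩ := hg
  refine ⟨C * D, fun N k => ?_⟩
  rw [norm_mul]
  exact mul_le_mul (hC N k) (hD N k) (norm_nonneg _) ((norm_nonneg _).trans (hC N k))

theorem exists_bound_prod {ι : Type*} (s : Finset ι) {f : ι → ℕ → ℕ → ℂ}
    (hf : ∀ i ∈ s, ∃ C, ∀ N k, ‖f i N k‖ ≤ C) : ∃ C, ∀ N k, ‖∏ i ∈ s, f i N k‖ ≤ C := by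
  classical
  induction s using Finset.induction_on with
  | empty => exact ⟨1, fun N k => by simp⟩
  | insert i s hi ih =>
    simp only [Finset.prod_insert hi]
    exact exists_bound_mul (hf i (Finset.mem_insert_self i s))
      (ih fun j hj => hf j (Finset.mem_insert_of_mem hj))

/-- The numerator of the residue of the truncated integrand, in reduced form. -/
noncomputable def residueNum (q : ℂ) (a b lam : Fin 3 → ℂ) (j : Fin 3) (N k : ℕ) : ℂ :=
  ∏ i, qPoch q (lam i * b j) (N + k) * qPoch q (q / (lam i * b j)) (N - k) *
    (qPoch q (a i * b j) k * (qPoch q (a i * b j) (N + k))⁻¹)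

/-- The inverse of the denominator of the residue of the truncated integrand, in reduced form. -/
noncomputable def residueDenInv (q : ℂ) (b : Fin 3 → ℂ) (j : Fin 3) (N k : ℕ) : ℂ :=
  ∏ l, if l = j then (qPoch q q k)⁻¹ * (qPoch q q (N - k - 1))⁻¹
    else (qPoch q (b l / b j) (N - k))⁻¹ * (qPoch q (q * b j / b l) k)⁻¹

section

variable {q : ℂ} (hq0 : q ≠ 0)
include hq0

/-- Reversing the order of the factors exposes the part that grows with `k`. Only the power of x⁻¹
depends on x, so most of the growth cancels between numerator and denominator of a residue. -/
theorem qPoch_reflect {x : ℂ} (hx : x ≠ 0) (k : ℕ) :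
    qPoch q (q / (x * q ^ k)) k =
      (∏ m ∈ Finset.range k, -(q ^ m)⁻¹) * (x⁻¹) ^ k * qPoch q x k := by
  induction k with
  | zero => simp [qPoch_zero]
  | succ k ih =>
    have e : q / (x * q ^ (k + 1)) * q = q / (x * q ^ k) := by rw [pow_succ]; field_simp
    have e' : 1 - q / (x * q ^ (k + 1)) = -(q ^ k)⁻¹ * x⁻¹ * (1 - x * q ^ k) := by
      rw [pow_succ]; field_simp; ring
    rw [qPoch_succ', e, e', ih, qPoch_succ, Finset.prod_range_succ]
    ring

theorem qPoch_reflect_of_le {x : ℂ} (hx : x ≠ 0) {k N : ℕ} (hk : k ≤ N) :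
    qPoch q (q / (x * q ^ k)) N =
      (∏ m ∈ Finset.range k, -(q ^ m)⁻¹) * (x⁻¹) ^ k *
        (qPoch q x k * qPoch q (q / x) (N - k)) := by
  have e : q / (x * q ^ k) * q ^ k = q / x := by field_simp
  obtain ⟨n, rfl⟩ := Nat.exists_eq_add_of_le hk
  rw [qPoch_add, qPoch_reflect hq0 hx, e, Nat.add_sub_cancel_left]
  ring

theorem prod_one_sub_pow_div {k N : ℕ} (hk : k < N) :
    ∏ m ∈ Finset.range N, (if m = k then 1 else 1 - q ^ m / q ^ k) =
      (∏ m ∈ Finset.range k, -(q ^ m)⁻¹) * (q⁻¹) ^ k *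
        (qPoch q q k * qPoch q q (N - k - 1)) := by
  obtain ⟨n, rfl⟩ : ∃ n, N = k + 1 + n := Nat.exists_eq_add_of_le hk
  rw [Finset.prod_range_add, Finset.prod_range_succ, if_pos rfl, mul_one]
  have e1 : ∏ m ∈ Finset.range k, (if m = k then 1 else 1 - q ^ m / q ^ k) =
      qPoch q (q / (q * q ^ k)) k := by
    refine Finset.prod_congr rfl fun m hm => ?_
    rw [if_neg (Finset.mem_range.1 hm).ne]
    field_simp
  have e2 : ∏ m ∈ Finset.range n, (if k + 1 + m = k then 1 else 1 - q ^ (k + 1 + m) / q ^ k) =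
      qPoch q q n := by
    refine Finset.prod_congr rfl fun m _ => ?_
    rw [if_neg (by lia), pow_add, pow_succ]
    field_simp
  have e3 : k + 1 + n - k - 1 = n := by lia
  rw [e1, e2, e3, qPoch_reflect hq0 hq0]
  ring

theorem truncResidue_eq (hq : ‖q‖ < 1) {a b lam : Fin 3 → ℂ} (hb : ∀ j, b j ≠ 0)
    (hl : ∀ j, lam j ≠ 0) (hbal : (∏ j, lam j) * ∏ j, b j = q ^ 2)
    (hab : ∀ i j, qPochInf q (a i * b j) ≠ 0) (j : Fin 3) {N k : ℕ} (hk : k < N) :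
    truncResidue q a b lam N j k =
      q ^ k * residueNum q a b lam j N k * residueDenInv q b j N k := by
  set ε := ∏ m ∈ Finset.range k, -(q ^ m)⁻¹ with hε
  have hε0 : ε ≠ 0 := Finset.prod_ne_zero_iff.2 fun m _ =>
    neg_ne_zero.2 (inv_ne_zero (pow_ne_zero _ hq0))
  have h1 : ∀ i, qPoch q (lam i * (b j * q ^ k)) N * qPoch q (q / (lam i * (b j * q ^ k))) N /
      qPoch q (a i * (b j * q ^ k)) N = (ε * ((lam i * b j)⁻¹) ^ k) *
      (qPoch q (lam i * b j) (N + k) * qPoch q (q / (lam i * b j)) (N - k) *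
        (qPoch q (a i * b j) k * (qPoch q (a i * b j) (N + k))⁻¹)) := by
    intro i
    have n1 := qPoch_ne_zero hq (hab i j) k
    have n2 := qPoch_ne_zero hq (hab i j) (N + k)
    rw [← mul_assoc, ← mul_assoc, qPoch_reflect_of_le hq0 (mul_ne_zero (hl i) (hb j)) hk.le,
      add_comm N k, qPoch_add q (lam i * b j), qPoch_add q (a i * b j), ← hε]
    rw [add_comm N k, qPoch_add] at n2
    have n3 := right_ne_zero_of_mul n2
    generalize qPoch q (a i * b j) k = A at *
    generalize qPoch q (a i * b j * q ^ k) N = B at *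
    field_simp
  have h2 : ∀ l, (if l = j then ∏ m ∈ Finset.range N, (if m = k then 1 else 1 - q ^ m / q ^ k)
      else qPoch q (b l / (b j * q ^ k)) N) = (ε * ((q * b j / b l)⁻¹) ^ k) *
      (if l = j then (qPoch q q k)⁻¹ * (qPoch q q (N - k - 1))⁻¹
        else (qPoch q (b l / b j) (N - k))⁻¹ * (qPoch q (q * b j / b l) k)⁻¹)⁻¹ := by
    intro l
    by_cases hlj : l = j
    · subst hlj
      rw [if_pos rfl, if_pos rfl, prod_one_sub_pow_div hq0 hk, mul_div_cancel_right₀ _ (hb l),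
        mul_inv, inv_inv, inv_inv]
    · have hbj := hb j
      have hbl := hb l
      have e : b l / (b j * q ^ k) = q / (q * b j / b l * q ^ k) := by field_simp
      have e' : q / (q * b j / b l) = b l / b j := by field_simp
      rw [if_neg hlj, if_neg hlj, e, qPoch_reflect_of_le hq0 (by positivity) hk.le, e',
        mul_inv, inv_inv, inv_inv]
      ring
  -- After reflection the growing factors leave ∏ (q/(λ_i b_i))^k, which is q^k by balancing. This
  -- is the argument q of the limiting ₃φ₂ series and the source of the summable bound.
  have h3 : (∏ i, (ε * ((lam i * b j)⁻¹) ^ k)) / ∏ l, (ε * ((q * b j / b l)⁻¹) ^ k) = q ^ k := by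
    rw [← Finset.prod_div_distrib]
    have : ∀ i, ε * ((lam i * b j)⁻¹) ^ k / (ε * ((q * b j / b i)⁻¹) ^ k) =
        (q / (lam i * b i)) ^ k := by
      intro i
      have := hl i
      have := hb i
      have := hb j
      rw [mul_div_mul_left _ _ hε0, ← div_pow]
      congr 1
      field_simp
    simp only [this]
    rw [Finset.prod_pow, Finset.prod_div_distrib, Finset.prod_mul_distrib, hbal]
    simp only [Finset.prod_const, Finset.card_univ, Fintype.card_fin]
    congr 1
    field_simp
  simp only [truncResidue, h1, h2]
  rw [Finset.prod_mul_distrib (f := fun i => ε * ((lam i * b j)⁻¹) ^ k),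
    Finset.prod_mul_distrib (f := fun l => ε * ((q * b j / b l)⁻¹) ^ k), Finset.prod_inv_distrib, mul_div_mul_comm,
    h3, div_inv_eq_mul, residueNum, residueDenInv]
  ring

end

section

variable {q : ℂ} (hq : ‖q‖ < 1)
include hq

theorem tendsto_residueNum {a b lam : Fin 3 → ℂ} (hab : ∀ i j, qPochInf q (a i * b j) ≠ 0)
    (j : Fin 3) (k : ℕ) :
    Tendsto (fun N => residueNum q a b lam j N k) atTop
      (𝓝 (∏ i, qTheta q (lam i * b j) * (qPoch q (a i * b j) k * (qPochInf q (a i * b j))⁻¹))) := by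
  unfold residueNum
  refine tendsto_finsetProd _ fun i _ => ?_
  have h1 := tendsto_add_atTop_nat k
  have h2 := tendsto_sub_atTop_nat k
  exact (((qPoch_tendsto hq _).comp h1).mul ((qPoch_tendsto hq _).comp h2)).mul
    ((((qPoch_tendsto hq _).comp h1).inv₀ (hab i j)).const_mul _)

theorem tendsto_residueDenInv {b : Fin 3 → ℂ}
    (hbb : ∀ l j, l ≠ j → qPochInf q (b l / b j) ≠ 0) (j : Fin 3) (k : ℕ) :
    Tendsto (fun N => residueDenInv q b j N k) atTop
      (𝓝 (∏ l, if l = j then (qPoch q q k)⁻¹ * (qPochInf q q)⁻¹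
        else (qPochInf q (b l / b j))⁻¹ * (qPoch q (q * b j / b l) k)⁻¹)) := by
  unfold residueDenInv
  refine tendsto_finsetProd _ fun l _ => ?_
  have h2 := tendsto_sub_atTop_nat k
  by_cases hl : l = j
  · simp only [hl, if_true]
    exact (((qPoch_tendsto hq _).comp ((tendsto_sub_atTop_nat 1).comp h2)).inv₀
      (qPochInf_self_ne_zero hq)).const_mul _
  · simp only [hl, if_false]
    exact (((qPoch_tendsto hq _).comp h2).inv₀ (hbb l j hl)).mul_const _

theorem exists_bound_residueNum {a b : Fin 3 → ℂ} (lam : Fin 3 → ℂ)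
    (hab : ∀ i j, qPochInf q (a i * b j) ≠ 0) (j : Fin 3) :
    ∃ C, ∀ N k, ‖residueNum q a b lam j N k‖ ≤ C := by
  unfold residueNum
  exact exists_bound_prod _ fun i _ => exists_bound_mul
    (exists_bound_mul ⟨_, fun _ _ => norm_qPoch_le hq _ _⟩ ⟨_, fun _ _ => norm_qPoch_le hq _ _⟩)
    (exists_bound_mul ⟨_, fun _ _ => norm_qPoch_le hq _ _⟩
      ⟨_, fun _ _ => norm_inv_qPoch_le hq (hab i j) _⟩)

theorem exists_bound_residueDenInv {b : Fin 3 → ℂ}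
    (hbb : ∀ l j, l ≠ j → qPochInf q (b l / b j) ≠ 0)
    (hbb' : ∀ l j, l ≠ j → qPochInf q (q * b j / b l) ≠ 0) (j : Fin 3) :
    ∃ C, ∀ N k, ‖residueDenInv q b j N k‖ ≤ C := by
  unfold residueDenInv
  refine exists_bound_prod _ fun l _ => ?_
  have hqq := qPochInf_self_ne_zero hq
  by_cases hl : l = j
  · simp only [hl, if_true]
    exact exists_bound_mul ⟨_, fun _ _ => norm_inv_qPoch_le hq hqq _⟩
      ⟨_, fun _ _ => norm_inv_qPoch_le hq hqq _⟩
  · simp only [hl, if_false]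
    exact exists_bound_mul ⟨_, fun _ _ => norm_inv_qPoch_le hq (hbb l j hl) _⟩
      ⟨_, fun _ _ => norm_inv_qPoch_le hq (hbb' l j hl) _⟩

theorem tendsto_sum_truncResidue (hq0 : q ≠ 0) {a b lam : Fin 3 → ℂ} (hb : ∀ j, b j ≠ 0)
    (hl : ∀ j, lam j ≠ 0) (hbal : (∏ j, lam j) * ∏ j, b j = q ^ 2)
    (hab : ∀ i j, qPochInf q (a i * b j) ≠ 0)
    (hbb : ∀ l j, l ≠ j → qPochInf q (b l / b j) ≠ 0)
    (hbb' : ∀ l j, l ≠ j → qPochInf q (q * b j / b l) ≠ 0) (j : Fin 3) :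
    Tendsto (fun N => ∑ k ∈ Finset.range N, truncResidue q a b lam N j k) atTop
      (𝓝 (∑' k, q ^ k *
        (∏ i, qTheta q (lam i * b j) * (qPoch q (a i * b j) k * (qPochInf q (a i * b j))⁻¹)) *
        ∏ l, if l = j then (qPoch q q k)⁻¹ * (qPochInf q q)⁻¹
          else (qPochInf q (b l / b j))⁻¹ * (qPoch q (q * b j / b l) k)⁻¹)) := by
  obtain ⟨C, hC⟩ := exists_bound_mul (exists_bound_residueNum hq lam hab j)
    (exists_bound_residueDenInv hq hbb hbb' j)
  have hC0 : 0 ≤ C := (norm_nonneg _).trans (hC 0 0)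
  -- Residues are extended by zero to k ≥ N so that a single series in `k` is dominated by C|q|^k.
  have h := tendsto_tsum_of_dominated_convergence (𝓕 := atTop)
    (f := fun N k => if k < N then truncResidue q a b lam N j k else 0)
    (g := fun k => q ^ k *
        (∏ i, qTheta q (lam i * b j) * (qPoch q (a i * b j) k * (qPochInf q (a i * b j))⁻¹)) *
        ∏ l, if l = j then (qPoch q q k)⁻¹ * (qPochInf q q)⁻¹
          else (qPochInf q (b l / b j))⁻¹ * (qPoch q (q * b j / b l) k)⁻¹)
    (bound := fun k => ‖q‖ ^ k * C)
    ((summable_geometric_of_lt_one (norm_nonneg _) hq).mul_right _) ?_ ?_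
  · refine h.congr fun N => ?_
    rw [tsum_eq_sum (s := Finset.range N) fun k hk => if_neg (by simpa using hk)]
    exact Finset.sum_congr rfl fun k hk => if_pos (Finset.mem_range.1 hk)
  · intro k
    refine (((tendsto_residueNum hq (lam := lam) hab j k).const_mul (q ^ k)).mul
      (tendsto_residueDenInv hq hbb j k)).congr' ?_
    filter_upwards [eventually_gt_atTop k] with N hN
    rw [if_pos hN, truncResidue_eq hq0 hq hb hl hbal hab j hN]
  · refine Eventually.of_forall fun N k => ?_
    by_cases hk : k < N
    · rw [if_pos hk, truncResidue_eq hq0 hq hb hl hbal hab j hk, mul_assoc, norm_mul, norm_pow]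
      exact mul_le_mul_of_nonneg_left (hC N k) (by positivity)
    · rw [if_neg hk, norm_zero]
      positivity

end

/-! ### The integral as a sum of three ₃φ₂ series -/

/-- The integrand `∏_j θ(λ_j z) / ((a_j z)_∞ (b_j / z)_∞) / z` of the contour integral. -/
noncomputable def thetaIntegrand (q : ℂ) (a b lam : Fin 3 → ℂ) (z : ℂ) : ℂ :=
  (∏ j, qTheta q (lam j * z) / (qPochInf q (a j * z) * qPochInf q (b j / z))) / z

section

variable {q : ℂ} (hq : ‖q‖ < 1)
include hq

/-- Multiplication by (q)_∞ ∏ (a_i b_j)_∞ removes the products attached to the chosen index `j` and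
leaves those of the other two, `l` and `m`; this is the normalization built into `poleSum`. The
hypothesis `hprod` says that j, l, m exhaust the indices. -/
theorem tsum_residue_eq {a b : Fin 3 → ℂ} (lam : Fin 3 → ℂ)
    (hab : ∀ i j, qPochInf q (a i * b j) ≠ 0) {j l m : Fin 3} (hl : l ≠ j) (hm : m ≠ j)
    (hprod : ∀ f : Fin 3 → ℂ, ∏ i, f i = f j * (f l * f m)) :
    (∑' k, q ^ k *
        (∏ i, qTheta q (lam i * b j) * (qPoch q (a i * b j) k * (qPochInf q (a i * b j))⁻¹)) *
        ∏ l, if l = j then (qPoch q q k)⁻¹ * (qPochInf q q)⁻¹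
          else (qPochInf q (b l / b j))⁻¹ * (qPoch q (q * b j / b l) k)⁻¹) *
      (qPochInf q q * ∏ i, ∏ j, qPochInf q (a i * b j)) =
    poleSum q (a 0) (a 1) (a 2) (b j) (b l) (b m) (∏ i, qTheta q (lam i * b j)) := by
  have h : ∀ k, q ^ k *
        (∏ i, qTheta q (lam i * b j) * (qPoch q (a i * b j) k * (qPochInf q (a i * b j))⁻¹)) *
        (∏ l, if l = j then (qPoch q q k)⁻¹ * (qPochInf q q)⁻¹
          else (qPochInf q (b l / b j))⁻¹ * (qPoch q (q * b j / b l) k)⁻¹) =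
      (∏ i, qTheta q (lam i * b j)) * (∏ i, qPochInf q (a i * b j))⁻¹ *
        ((qPochInf q q)⁻¹ * (qPochInf q (b l / b j))⁻¹ * (qPochInf q (b m / b j))⁻¹) *
        phi32Term q (a 0 * b j) (a 1 * b j) (a 2 * b j) (q * b j / b l) (q * b j / b m) k := by
    intro k
    rw [hprod fun l => if l = j then (qPoch q q k)⁻¹ * (qPochInf q q)⁻¹
          else (qPochInf q (b l / b j))⁻¹ * (qPoch q (q * b j / b l) k)⁻¹, if_pos rfl, if_neg hl,
      if_neg hm, Finset.prod_mul_distrib, Finset.prod_mul_distrib, Finset.prod_inv_distrib,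
      phi32Term, Fin.prod_univ_three fun i => qPoch q (a i * b j) k]
    simp only [div_eq_mul_inv (q ^ k * _), mul_inv]
    ring
  have hP : ∏ i, ∏ j, qPochInf q (a i * b j) = (∏ i, qPochInf q (a i * b j)) *
      ((∏ i, qPochInf q (a i * b l)) * ∏ i, qPochInf q (a i * b m)) := by
    rw [Finset.prod_comm, hprod]
  have h1 : ∏ i, qPochInf q (a i * b j) ≠ 0 := Finset.prod_ne_zero_iff.2 fun i _ => hab i j
  simp only [h]
  rw [tsum_mul_left, hP, poleSum, phi32, Fin.prod_univ_three fun i => qPochInf q (a i * b l),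
    Fin.prod_univ_three fun i => qPochInf q (a i * b m)]
  have h2 := qPochInf_self_ne_zero hq
  generalize ∏ i, qPochInf q (a i * b j) = w at h1 ⊢
  generalize qPochInf q (b l / b j) = u, qPochInf q (b m / b j) = v,
    ∏ i, qTheta q (lam i * b j) = x, ∑' k, phi32Term q _ _ _ _ _ k = y
  field_simp

theorem IsSeparatingContour.qPochInf_mul_ne_zero {a b : Fin 3 → ℂ} {p : ℂ} {γ : Path p p}
    (hγ : IsSeparatingContour q a b γ) (ha : ∀ j, a j ≠ 0) (j : Fin 3) :
    ∀ z ∈ Set.range γ, qPochInf q (a j * z) ≠ 0 := by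
  rintro _ ⟨t, rfl⟩ h
  obtain ⟨k, hk⟩ := (qPochInf_eq_zero_iff hq _).1 h
  refine hγ.ne_outer j k t ?_
  have := ha j
  rw [← mul_inv]
  exact eq_inv_of_mul_eq_one_left (by linear_combination hk)

theorem IsSeparatingContour.qPochInf_div_ne_zero {a b : Fin 3 → ℂ} {p : ℂ} {γ : Path p p}
    (hγ : IsSeparatingContour q a b γ) (j : Fin 3) :
    ∀ z ∈ Set.range γ, qPochInf q (b j / z) ≠ 0 := by
  rintro _ ⟨t, rfl⟩ h
  obtain ⟨k, hk⟩ := (qPochInf_eq_zero_iff hq _).1 h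
  rw [div_mul_eq_mul_div, div_eq_one_iff_eq (hγ.ne_zero t)] at hk
  exact hγ.ne_inner j k t hk.symm

theorem tendsto_contourIntegral_truncIntegrand {a b lam : Fin 3 → ℂ} (ha : ∀ j, a j ≠ 0)
    (hl : ∀ j, lam j ≠ 0) {p : ℂ} {γ : Path p p} (hγ : IsSeparatingContour q a b γ) :
    Tendsto (fun N => contourIntegral (truncIntegrand q a b lam N) γ) atTop
      (𝓝 (contourIntegral (thetaIntegrand q a b lam) γ)) := by
  have hz : ∀ z ∈ Set.range γ, z ≠ 0 := by rintro _ ⟨t, rfl⟩; exact hγ.ne_zero t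
  have hA := hγ.qPochInf_mul_ne_zero hq ha
  have hB := hγ.qPochInf_div_ne_zero hq
  have hcd : ∀ c : ℂ, ContinuousOn (fun z => c / z) (Set.range γ) := fun c =>
    continuousOn_const.div continuousOn_id hz
  have hcd' : ∀ j, ContinuousOn (fun z => q / (lam j * z)) (Set.range γ) := fun j =>
    continuousOn_const.div (by fun_prop) fun z h => mul_ne_zero (hl j) (hz z h)
  have hpc := continuous_qPochInf hq
  have hpn : ∀ n, Continuous fun x => qPoch q x n := fun n => (differentiable_qPoch q n).continuous
  set E : ℂ → ℝ := fun x => Real.exp (‖x‖ / (1 - ‖q‖)) with hE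
  have hEc : Continuous E := by simp only [hE]; fun_prop
  -- `G` majorizes the truncated integrands for all `N` at once. It is continuous on the compact
  -- range of the contour, hence bounded there.
  set G : ℂ → ℝ := fun z => (∏ j, E (lam j * z) * E (q / (lam j * z)) *
    ((E (a j * z) * ‖(qPochInf q (a j * z))⁻¹‖) * (E (b j / z) * ‖(qPochInf q (b j / z))⁻¹‖))) *
    ‖z⁻¹‖ with hG
  have hGc : ContinuousOn G (Set.range γ) := by
    refine ContinuousOn.mul (continuousOn_finsetProd _ fun j _ => ?_)
      (continuousOn_inv₀.mono hz).norm
    refine ((hEc.comp_continuousOn (by fun_prop)).mul (hEc.comp_continuousOn (hcd' j))).mul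
      (((hEc.comp_continuousOn (by fun_prop)).mul ?_).mul
        ((hEc.comp_continuousOn (hcd (b j))).mul ?_))
    · exact ((hpc.comp_continuousOn (by fun_prop)).inv₀ (hA j)).norm
    · exact ((hpc.comp_continuousOn (hcd (b j))).inv₀ (hB j)).norm
  obtain ⟨C, hC⟩ := (isCompact_range γ.continuous).exists_bound_of_continuousOn hGc
  refine tendsto_contourIntegral hγ.piecewiseC1 (C := C) ?_ ?_ ?_
  · refine Eventually.of_forall fun N => ContinuousOn.div ?_ continuousOn_id hz
    refine continuousOn_finsetProd _ fun j _ => ContinuousOn.div ?_ ?_ ?_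
    · exact ((hpn N).comp_continuousOn (by fun_prop)).mul ((hpn N).comp_continuousOn (hcd' j))
    · exact ((hpn N).comp_continuousOn (by fun_prop)).mul ((hpn N).comp_continuousOn (hcd (b j)))
    · exact fun z h => mul_ne_zero (qPoch_ne_zero hq (hA j z h) N) (qPoch_ne_zero hq (hB j z h) N)
  · refine Eventually.of_forall fun N z h => le_trans ?_ ((Real.le_norm_self _).trans (hC z h))
    rw [truncIntegrand, div_eq_mul_inv, norm_mul, norm_prod]
    refine mul_le_mul_of_nonneg_right (Finset.prod_le_prod (fun _ _ => norm_nonneg _) fun j _ => ?_)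
      (norm_nonneg _)
    rw [div_eq_mul_inv, mul_inv, norm_mul, norm_mul, norm_mul]
    gcongr
    · exact norm_qPoch_le hq _ N
    · exact norm_qPoch_le hq _ N
    · exact norm_inv_qPoch_le hq (hA j z h) N
    · exact norm_inv_qPoch_le hq (hB j z h) N
  · intro z h
    refine Tendsto.div_const (tendsto_finsetProd _ fun j _ => Tendsto.div ?_ ?_ ?_) z
    · exact (qPoch_tendsto hq _).mul (qPoch_tendsto hq _)
    · exact (qPoch_tendsto hq _).mul (qPoch_tendsto hq _)
    · exact mul_ne_zero (hA j z h) (hB j z h)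

theorem contourIntegral_eq_totalPoleSum (hq0 : q ≠ 0) {a b lam : Fin 3 → ℂ} (ha : ∀ j, a j ≠ 0)
    (hb : ∀ j, b j ≠ 0) (hl : ∀ j, lam j ≠ 0) (hbal : (∏ j, lam j) * ∏ j, b j = q ^ 2)
    (hab : ∀ i j, qPochInf q (a i * b j) ≠ 0)
    (hbb : ∀ i j, i ≠ j → ∀ k : ℤ, b i / b j ≠ q ^ k)
    {p : ℂ} {γ : Path p p} (hγ : IsSeparatingContour q a b γ) :
    (2 * Real.pi * Complex.I)⁻¹ * contourIntegral (thetaIntegrand q a b lam) γ *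
        (qPochInf q q * ∏ i, ∏ j, qPochInf q (a i * b j)) =
      totalPoleSum q (a 0) (a 1) (a 2) (b 0) (b 1) (b 2)
        fun x => qTheta q (lam 0 * x) * qTheta q (lam 1 * x) * qTheta q (lam 2 * x) := by
  have hbb₁ : ∀ l j, l ≠ j → qPochInf q (b l / b j) ≠ 0 := fun l j hlj =>
    left_ne_zero_of_mul (qTheta_ne_zero hq hq0 (div_ne_zero (hb l) (hb j)) (hbb l j hlj))
  have hbb₂ : ∀ l j, l ≠ j → qPochInf q (q * b j / b l) ≠ 0 := fun l j hlj =>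
    qPochInf_q_mul_div_ne_zero hq hq0 (hb j) (hb l) (hbb j l hlj.symm)
  have h1 := (tendsto_contourIntegral_truncIntegrand hq ha hl hγ).const_mul
    (2 * Real.pi * Complex.I : ℂ)⁻¹
  simp only [contourIntegral_truncIntegrand hq hq0 ha hb hl hbal hbb hγ] at h1
  have h2 := (tendsto_pow_atTop_nhds_zero_of_norm_lt_one hq).add
    (tendsto_finsetSum Finset.univ fun j _ =>
      tendsto_sum_truncResidue hq hq0 hb hl hbal hab hbb₁ hbb₂ j)
  rw [tendsto_nhds_unique h1 h2, zero_add, Finset.sum_mul, Fin.sum_univ_three,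
    tsum_residue_eq hq lam hab (j := 0) (l := 1) (m := 2) (by decide) (by decide)
      (fun f => by rw [Fin.prod_univ_three]; ring),
    tsum_residue_eq hq lam hab (j := 1) (l := 0) (m := 2) (by decide) (by decide)
      (fun f => by rw [Fin.prod_univ_three]; ring),
    tsum_residue_eq hq lam hab (j := 2) (l := 0) (m := 1) (by decide) (by decide)
      (fun f => by rw [Fin.prod_univ_three]; ring), totalPoleSum, Fin.prod_univ_three,
    Fin.prod_univ_three, Fin.prod_univ_three]

end

/-! ### Stability of separating contours and generic perturbations -/

/-- On the path the quotient (z - w')/(z - w) lies in the unit disc around 1, so its principal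
logarithm is a primitive of the difference of the two integrands. -/
theorem windingNumber_eq_of_norm_lt {p : ℂ} {γ : Path p p} (hγ : IsPiecewiseC1 γ) {w w' : ℂ}
    (h : ∀ z ∈ Set.range γ, ‖w' - w‖ < ‖z - w‖) : windingNumber γ w' = windingNumber γ w := by
  have h1 : ∀ z ∈ Set.range γ, z - w ≠ 0 := fun z hz =>
    norm_pos_iff.1 ((norm_nonneg _).trans_lt (h z hz))
  have h2 : ∀ z ∈ Set.range γ, z - w' ≠ 0 := fun z hz h0 => by
    have := h z hz
    rw [← sub_eq_zero.1 h0] at this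
    exact lt_irrefl _ this
  have hc1 : ContinuousOn (fun z => (z - w)⁻¹) (Set.range γ) := ContinuousOn.inv₀ (by fun_prop) h1
  have hc2 : ContinuousOn (fun z => (z - w')⁻¹) (Set.range γ) := ContinuousOn.inv₀ (by fun_prop) h2
  have hc3 : ContinuousOn (fun z => -1 * (z - w)⁻¹) (Set.range γ) := continuousOn_const.mul hc1
  have key : contourIntegral (fun z => (z - w')⁻¹ + -1 * (z - w)⁻¹) γ = 0 := by
    refine contourIntegral_eq_zero_of_hasDerivAt hγ
      (F := fun z => Complex.log ((z - w') / (z - w))) (fun z hz => ?_)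
      (hc2.add hc3)
    have e1 := h1 z hz
    have e2 := h2 z hz
    have hs : (z - w') / (z - w) ∈ Complex.slitPlane := by
      have : (z - w') / (z - w) = 1 + -((w' - w) / (z - w)) := by field_simp; ring
      rw [this]
      refine Complex.mem_slitPlane_of_norm_lt_one ?_
      rw [norm_neg, norm_div, div_lt_one (norm_pos_iff.2 e1)]
      exact h z hz
    refine (HasDerivAt.clog (((hasDerivAt_id' z).sub_const w').fun_div
      ((hasDerivAt_id' z).sub_const w) e1) hs).congr_deriv ?_
    field_simp
    ring
  rw [contourIntegral_add hγ hc2 hc3, contourIntegral_const_mul,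
    contourIntegral_inv, contourIntegral_inv, neg_one_mul, ← sub_eq_add_neg, sub_eq_zero] at key
  exact mul_left_cancel₀ (by simp [Real.pi_ne_zero]) key

/-- A separating contour stays separating when the inner poles move a little. -/
theorem IsSeparatingContour.exists_pos_of_norm_sub_lt {q : ℂ} (hq : ‖q‖ < 1) {a b : Fin 3 → ℂ}
    {p : ℂ} {γ : Path p p} (hγ : IsSeparatingContour q a b γ) :
    ∃ δ > 0, ∀ b' : Fin 3 → ℂ, (∀ j, ‖b' j - b j‖ < δ) → IsSeparatingContour q a b' γ := by
  -- The inner poles together with their limit 0 form a compact set at positive distance from the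
  -- contour. Since |q| < 1, moving b_j by less than δ moves every b_j q^k by less than δ.
  have hK : IsCompact (⋃ j, insert (0 : ℂ) (Set.range fun k : ℕ => b j * q ^ k)) := by
    refine isCompact_iUnion fun j => Tendsto.isCompact_insert_range ?_
    simpa using (tendsto_pow_atTop_nhds_zero_of_norm_lt_one hq).const_mul (b j)
  have hd : Disjoint (⋃ j, insert (0 : ℂ) (Set.range fun k : ℕ => b j * q ^ k)) (Set.range γ) := by
    rw [Set.disjoint_right]
    rintro _ ⟨t, rfl⟩ h
    obtain ⟨j, h | ⟨k, h⟩⟩ := Set.mem_iUnion.1 h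
    · exact hγ.ne_zero t h
    · exact hγ.ne_inner j k t h.symm
  obtain ⟨δ, hδ, hdist⟩ := Metric.exists_pos_forall_lt_edist hK (isCompact_range γ.continuous).isClosed hd
  refine ⟨δ, by exact_mod_cast hδ, fun b' hb' => ?_⟩
  have hlt : ∀ j k, ∀ z ∈ Set.range γ, ‖b' j * q ^ k - b j * q ^ k‖ < ‖z - b j * q ^ k‖ := by
    intro j k z hz
    have h1 := hdist (b j * q ^ k) (Set.mem_iUnion.2 ⟨j, Or.inr ⟨k, rfl⟩⟩) z hz
    rw [edist_nndist, ENNReal.coe_lt_coe] at h1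
    have h2 : (δ : ℝ) < ‖z - b j * q ^ k‖ := by
      rw [← dist_eq_norm, dist_comm]
      exact_mod_cast h1
    refine lt_of_le_of_lt ?_ ((hb' j).trans h2)
    rw [← sub_mul, norm_mul, norm_pow]
    exact mul_le_of_le_one_right (norm_nonneg _) (pow_le_one₀ (norm_nonneg _) hq.le)
  exact
    { piecewiseC1 := hγ.piecewiseC1
      ne_zero := hγ.ne_zero
      ne_inner := fun j k t h => lt_irrefl _ (h ▸ hlt j k (γ t) ⟨t, rfl⟩)
      ne_outer := hγ.ne_outer
      winding_zero := hγ.winding_zero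
      winding_inner := fun j k =>
        (windingNumber_eq_of_norm_lt hγ.piecewiseC1 (hlt j k)).trans (hγ.winding_inner j k)
      winding_outer := hγ.winding_outer }

/-- The modulus of c e^(ms) is injective in s, so each power of q is attained at most once. -/
theorem countable_setOf_mul_exp_eq_zpow (q : ℂ) {c : ℂ} (hc : c ≠ 0) {m : ℝ} (hm : m ≠ 0) :
    {s : ℝ | ∃ k : ℤ, c * Complex.exp (m * s) = q ^ k}.Countable := by
  rw [Set.ofPred_exists]
  refine Set.countable_iUnion fun k => Set.Subsingleton.countable fun s hs t ht => ?_
  have h : c * Complex.exp (m * s) = c * Complex.exp (m * t) := hs.trans ht.symm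
  have h' := congrArg norm (mul_left_cancel₀ hc h)
  rw [Complex.norm_exp, Complex.norm_exp] at h'
  simpa [hm] using h'

theorem ae_mul_exp_ne_zpow (q : ℂ) {c : ℂ} (hc : c ≠ 0) {m : ℝ} (hm : m ≠ 0) :
    ∀ᵐ s : ℝ, ∀ k : ℤ, c * Complex.exp (m * s) ≠ q ^ k := by
  filter_upwards [(countable_setOf_mul_exp_eq_zpow q hc hm).ae_notMem _] with s hs k h
  exact hs ⟨k, h⟩

theorem eq_of_tendsto_of_ae {f g : ℝ → ℂ} {P : ℝ → Prop} {x₀ : ℝ} {u v : ℂ} (hP : ∀ᵐ x, P x)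
    (hf : Tendsto f (𝓝 x₀) (𝓝 u)) (hg : Tendsto g (𝓝 x₀) (𝓝 v))
    (h : ∀ᶠ x in 𝓝 x₀, P x → f x = g x) : u = v := by
  have := mem_closure_iff_nhdsWithin_neBot.1 (MeasureTheory.Measure.dense_of_ae hP x₀)
  refine tendsto_nhds_unique_of_eventuallyEq (hf.mono_left nhdsWithin_le_nhds)
    (hg.mono_left nhdsWithin_le_nhds) (l := 𝓝[{x | P x}] x₀) ?_
  filter_upwards [self_mem_nhdsWithin, nhdsWithin_le_nhds h] with x hx h' using h' hx

/-! ### Continuity in the parameters and removal of genericity -/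

section

variable {q : ℂ} (hq : ‖q‖ < 1)
include hq

theorem ContinuousOn.qTheta {X : Type*} [TopologicalSpace X] {s : Set X} {f : X → ℂ}
    (hf : ContinuousOn f s) (h0 : ∀ x ∈ s, f x ≠ 0) :
    ContinuousOn (fun x => _root_.qTheta q (f x)) s := fun x hx =>
  (differentiableAt_qTheta hq (h0 x hx)).continuousAt.comp_continuousWithinAt (hf x hx)

theorem Continuous.qTheta {X : Type*} [TopologicalSpace X] {f : X → ℂ}
    (hf : Continuous f) (h0 : ∀ x, f x ≠ 0) : Continuous fun x => _root_.qTheta q (f x) :=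
  continuousOn_univ.1 (hf.continuousOn.qTheta hq fun x _ => h0 x)

/-- The contour integral depends continuously on parameters. -/
theorem tendsto_contourIntegral_thetaIntegrand {a : Fin 3 → ℂ} (ha : ∀ j, a j ≠ 0)
    {B L : ℝ → Fin 3 → ℂ} (hB : ∀ j, Continuous fun s => B s j)
    (hL : ∀ j, Continuous fun s => L s j) (hL0 : ∀ s j, L s j ≠ 0) {p : ℂ} {γ : Path p p}
    {ε : ℝ} (hε : 0 < ε) (hγ : ∀ s ∈ Metric.closedBall (0 : ℝ) ε, IsSeparatingContour q a (B s) γ) :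
    Tendsto (fun s => contourIntegral (thetaIntegrand q a (B s) (L s)) γ) (𝓝 0)
      (𝓝 (contourIntegral (thetaIntegrand q a (B 0) (L 0)) γ)) := by
  have h0 : IsSeparatingContour q a (B 0) γ := hγ 0 (Metric.mem_closedBall_self hε.le)
  have hz : ∀ z ∈ Set.range γ, z ≠ 0 := by rintro _ ⟨t, rfl⟩; exact h0.ne_zero t
  have hpc := continuous_qPochInf hq
  have hc : ContinuousOn (fun x : ℝ × ℂ => thetaIntegrand q a (B x.1) (L x.1) x.2)
      (Metric.closedBall 0 ε ×ˢ Set.range γ) := by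
    have hBc : ∀ j, Continuous fun x : ℝ × ℂ => B x.1 j := fun j => (hB j).comp continuous_fst
    have hLc : ∀ j, Continuous fun x : ℝ × ℂ => L x.1 j := fun j => (hL j).comp continuous_fst
    refine ContinuousOn.div (continuousOn_finsetProd _ fun j _ => ContinuousOn.div ?_ ?_ ?_)
      continuousOn_snd fun x hx => hz _ hx.2
    · exact ((hLc j).mul continuous_snd).continuousOn.qTheta hq
        fun x hx => mul_ne_zero (hL0 _ j) (hz _ hx.2)
    · exact (hpc.comp_continuousOn (by fun_prop)).mul (hpc.comp_continuousOn
        ((hBc j).continuousOn.div continuousOn_snd fun x hx => hz _ hx.2))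
    · exact fun x hx => mul_ne_zero (h0.qPochInf_mul_ne_zero hq ha j _ hx.2)
        ((hγ _ hx.1).qPochInf_div_ne_zero hq j _ hx.2)
  obtain ⟨C, hC⟩ := ((isCompact_closedBall (0 : ℝ) ε).prod
    (isCompact_range γ.continuous)).exists_bound_of_continuousOn hc
  have hmem := Metric.closedBall_mem_nhds (0 : ℝ) hε
  refine tendsto_contourIntegral h0.piecewiseC1 (C := C) ?_ ?_ fun z hz => ?_
  · filter_upwards [hmem] with s hs
    exact hc.comp (f := fun z => (s, z)) (by fun_prop) fun z hz => ⟨hs, hz⟩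
  · filter_upwards [hmem] with s hs z hz
    exact hC (s, z) ⟨hs, hz⟩
  · exact (hc.comp (f := fun s => (s, z)) (by fun_prop) fun s hs => ⟨hs, hz⟩).continuousAt hmem

/-- The formula with the denominators cleared, for parameters in general position. -/
theorem contourIntegral_thetaIntegrand_of_generic (hq0 : q ≠ 0) {a b lam : Fin 3 → ℂ}
    (ha : ∀ j, a j ≠ 0) (hb : ∀ j, b j ≠ 0) (hl : ∀ j, lam j ≠ 0)
    (hbal₁ : ∏ j, lam j = q * ∏ j, a j) (hbal₂ : (∏ j, a j) * ∏ j, b j = q)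
    (hab : ∀ i j, qPochInf q (a i * b j) ≠ 0)
    (h₁₂ : ∀ k : ℤ, b 0 / b 1 ≠ q ^ k) (h₁₃ : ∀ k : ℤ, b 0 / b 2 ≠ q ^ k)
    (h₂₃ : ∀ k : ℤ, b 1 / b 2 ≠ q ^ k) (hlb : ∀ k : ℤ, lam 1 * b 2 ≠ q ^ k)
    (hab₃ : ∀ k : ℤ, a 2 * b 2 ≠ q ^ k) (hal : ∀ k : ℤ, a 2 / lam 1 ≠ q ^ k)
    (g₁ : ∀ k : ℤ, a 0 * a 1 * b 0 / lam 1 ≠ q ^ k)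
    (g₂ : ∀ k : ℤ, a 0 * a 1 * b 1 / lam 1 ≠ q ^ k)
    {p : ℂ} {γ : Path p p} (hγ : IsSeparatingContour q a b γ) :
    (2 * Real.pi * Complex.I)⁻¹ * contourIntegral (thetaIntegrand q a b lam) γ *
        (qPochInf q q * ∏ i, ∏ j, qPochInf q (a i * b j)) * qTheta q (lam 0 / lam 1) =
      (∏ j, qTheta q (lam 0 / a j) * qTheta q (lam 1 * b j))
          - lam 0 / lam 1 * ∏ j, qTheta q (lam 0 * b j) * qTheta q (lam 1 / a j) := by
  have hbb : ∀ i j, i ≠ j → ∀ k : ℤ, b i / b j ≠ q ^ k := by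
    intro i j hij
    fin_cases i <;> fin_cases j <;> first | exact absurd rfl hij | skip
    · exact h₁₂
    · exact h₁₃
    · exact ne_zpow_inv h₁₂
    · exact h₂₃
    · exact ne_zpow_inv h₁₃
    · exact ne_zpow_inv h₂₃
  rw [contourIntegral_eq_totalPoleSum hq hq0 ha hb hl
    (by rw [hbal₁, mul_assoc, hbal₂, sq]) hab hbb hγ]
  rw [Fin.prod_univ_three] at hbal₁ hbal₂
  rw [Fin.prod_univ_three] at hbal₁ hbal₂
  rw [totalPoleSum_eq hq hq0 (ha 0) (ha 1) (ha 2) (hb 0) (hb 1) (hb 2) (hl 0) (hl 1) (hl 2)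
    (by rw [← hbal₂]; ring) hbal₁ h₁₂ h₁₃ h₂₃ hlb hab₃ hal g₁ g₂,
    Fin.prod_univ_three, Fin.prod_univ_three]
  ring

/-- The formula with the denominators cleared. -/
theorem contourIntegral_thetaIntegrand (hq0 : q ≠ 0) {a b lam : Fin 3 → ℂ}
    (ha : ∀ j, a j ≠ 0) (hb : ∀ j, b j ≠ 0) (hl : ∀ j, lam j ≠ 0)
    (hbal₁ : ∏ j, lam j = q * ∏ j, a j) (hbal₂ : (∏ j, a j) * ∏ j, b j = q)
    (hab : ∀ i j, qPochInf q (a i * b j) ≠ 0)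
    {p : ℂ} {γ : Path p p} (hγ : IsSeparatingContour q a b γ) :
    (2 * Real.pi * Complex.I)⁻¹ * contourIntegral (thetaIntegrand q a b lam) γ *
        (qPochInf q q * ∏ i, ∏ j, qPochInf q (a i * b j)) * qTheta q (lam 0 / lam 1) =
      (∏ j, qTheta q (lam 0 / a j) * qTheta q (lam 1 * b j))
          - lam 0 / lam 1 * ∏ j, qTheta q (lam 0 * b j) * qTheta q (lam 1 / a j) := by
  obtain ⟨δ, hδ, hsep⟩ := hγ.exists_pos_of_norm_sub_lt hq
  -- Both exponent vectors sum to zero, which preserves the balancing conditions. They are chosen so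
  -- that every ratio required to avoid q^ℤ has a nonzero exponent: m_i - m_j, n₁ + m₂, m₂, -n₁, m₀
  -- - n₁ and m₁ - n₁. The a_j stay fixed, so the outer poles do not move.
  set m : Fin 3 → ℝ := ![1, 2, -3] with hm
  set n : Fin 3 → ℝ := ![0, 4, -4] with hn
  set B : ℝ → Fin 3 → ℂ := fun s j => b j * Complex.exp (m j * s) with hB
  set L : ℝ → Fin 3 → ℂ := fun s j => lam j * Complex.exp (n j * s) with hL
  have hB0 : ∀ s j, B s j ≠ 0 := fun s j => mul_ne_zero (hb j) (Complex.exp_ne_zero _)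
  have hL0 : ∀ s j, L s j ≠ 0 := fun s j => mul_ne_zero (hl j) (Complex.exp_ne_zero _)
  have hBc : ∀ j, Continuous fun s => B s j := fun j => by simp only [hB]; fun_prop
  have hLc : ∀ j, Continuous fun s => L s j := fun j => by simp only [hL]; fun_prop
  have hBz : B 0 = b := by ext j; simp [hB]
  have hLz : L 0 = lam := by ext j; simp [hL]
  have hnear : ∀ᶠ s in 𝓝 (0 : ℝ), ∀ j, ‖B s j - b j‖ < δ := by
    refine eventually_all.2 fun j => ?_
    have : Continuous fun s => ‖B s j - b j‖ := ((hBc j).sub continuous_const).norm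
    exact this.continuousAt.eventually_lt continuousAt_const (by simpa [hBz] using hδ)
  obtain ⟨ε, hε, hball⟩ := Metric.nhds_basis_closedBall.eventually_iff.1 hnear
  have hγs : ∀ s ∈ Metric.closedBall (0 : ℝ) ε, IsSeparatingContour q a (B s) γ := fun s hs =>
    hsep _ (hball hs)
  have hLB : ∀ s, Complex.exp (n 0 * s) * Complex.exp (n 1 * s) * Complex.exp (n 2 * s) = 1 := by
    intro s
    rw [← Complex.exp_add, ← Complex.exp_add, ← Complex.exp_zero]
    congr 1; simp [hn]
  have hmB : ∀ s, Complex.exp (m 0 * s) * Complex.exp (m 1 * s) * Complex.exp (m 2 * s) = 1 := by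
    intro s
    rw [← Complex.exp_add, ← Complex.exp_add, ← Complex.exp_zero]
    congr 1; simp [hm]; ring
  have hpc := continuous_qPochInf hq
  have hPc : ∀ i j, Continuous fun s => qPochInf q (a i * B s j) := fun i j =>
    hpc.comp (continuous_const.mul (hBc j))
  have hgen : ∀ {c : ℂ} {f : ℝ → ℂ} (r : ℝ), r ≠ 0 → c ≠ 0 →
      (∀ s : ℝ, f s = c * Complex.exp (r * s)) → ∀ᵐ s : ℝ, ∀ k : ℤ, f s ≠ q ^ k := by
    intro c f r hr hc hf
    filter_upwards [ae_mul_exp_ne_zpow q hc hr] with s hs k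
    rw [hf]; exact hs k
  have hBB : ∀ i j, m i - m j ≠ 0 → ∀ᵐ s : ℝ, ∀ k : ℤ, B s i / B s j ≠ q ^ k := fun i j hij =>
    hgen (m i - m j) hij (div_ne_zero (hb i) (hb j)) fun s => by
      simp only [hB]
      push_cast
      rw [sub_mul, Complex.exp_sub]
      ring
  have hLB₂ : ∀ᵐ s : ℝ, ∀ k : ℤ, L s 1 * B s 2 ≠ q ^ k :=
    hgen (n 1 + m 2) (by simp [hm, hn]; norm_num) (mul_ne_zero (hl 1) (hb 2)) fun s => by
      simp only [hB, hL]
      push_cast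
      rw [add_mul, Complex.exp_add]
      ring
  have haB : ∀ᵐ s : ℝ, ∀ k : ℤ, a 2 * B s 2 ≠ q ^ k :=
    hgen (m 2) (by simp [hm]) (mul_ne_zero (ha 2) (hb 2)) fun s => by
      simp only [hB]
      ring
  have haL : ∀ᵐ s : ℝ, ∀ k : ℤ, a 2 / L s 1 ≠ q ^ k :=
    hgen (-n 1) (by simp [hn]) (div_ne_zero (ha 2) (hl 1)) fun s => by
      simp only [hL]
      push_cast
      rw [neg_mul, Complex.exp_neg]
      ring
  have hg : ∀ j, m j - n 1 ≠ 0 → ∀ᵐ s : ℝ, ∀ k : ℤ, a 0 * a 1 * B s j / L s 1 ≠ q ^ k :=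
    fun j hj => hgen (m j - n 1) hj
      (div_ne_zero (mul_ne_zero (mul_ne_zero (ha 0) (ha 1)) (hb j)) (hl 1)) fun s => by
      simp only [hB, hL]
      push_cast
      rw [sub_mul, Complex.exp_sub]
      ring
  have hall := (hBB 0 1 (by simp [hm]; norm_num)).and ((hBB 0 2 (by simp [hm]; norm_num)).and
    ((hBB 1 2 (by simp [hm]; norm_num)).and (hLB₂.and (haB.and (haL.and
      ((hg 0 (by simp [hm, hn]; norm_num)).and (hg 1 (by simp [hm, hn]; norm_num))))))))
  -- The condition (a_i b_j)_∞ ≠ 0 is open and already holds at s = 0, so it persists nearby, in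
  -- contrast to the conditions that hold only almost everywhere.
  have hP0 : ∀ i j, ∀ᶠ s in 𝓝 (0 : ℝ), qPochInf q (a i * B s j) ≠ 0 := fun i j =>
    (hPc i j).continuousAt.eventually_ne (by simpa [hBz] using hab i j)
  have hev := (eventually_all.2 fun i => eventually_all.2 fun j => hP0 i j).and
    (Metric.closedBall_mem_nhds (0 : ℝ) hε)
  have hlhs : Tendsto (fun s => (2 * Real.pi * Complex.I)⁻¹ *
      contourIntegral (thetaIntegrand q a (B s) (L s)) γ *
        (qPochInf q q * ∏ i, ∏ j, qPochInf q (a i * B s j)) * qTheta q (L s 0 / L s 1)) (𝓝 0)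
      (𝓝 ((2 * Real.pi * Complex.I)⁻¹ *
      contourIntegral (thetaIntegrand q a (B 0) (L 0)) γ *
        (qPochInf q q * ∏ i, ∏ j, qPochInf q (a i * B 0 j)) * qTheta q (L 0 0 / L 0 1))) := by
    refine ((tendsto_contourIntegral_thetaIntegrand hq ha hBc hLc hL0 hε hγs).const_mul _).mul
      (Continuous.tendsto ?_ 0) |>.mul (Continuous.tendsto ?_ 0)
    · exact continuous_const.mul (continuous_finsetProd _ fun i _ =>
        continuous_finsetProd _ fun j _ => hPc i j)
    · exact ((hLc 0).div (hLc 1) fun s => hL0 s 1).qTheta hq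
        fun s => div_ne_zero (hL0 s 0) (hL0 s 1)
  have hrhs : Continuous fun s => (∏ j, qTheta q (L s 0 / a j) * qTheta q (L s 1 * B s j))
          - L s 0 / L s 1 * ∏ j, qTheta q (L s 0 * B s j) * qTheta q (L s 1 / a j) := by
    have hLa : ∀ i j, Continuous fun s => qTheta q (L s i / a j) := fun i j =>
      ((hLc i).div_const _).qTheta hq fun s => div_ne_zero (hL0 s i) (ha j)
    have hLB' : ∀ i j, Continuous fun s => qTheta q (L s i * B s j) := fun i j =>
      ((hLc i).mul (hBc j)).qTheta hq fun s => mul_ne_zero (hL0 s i) (hB0 s j)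
    exact (continuous_finsetProd _ fun j _ => (hLa 0 j).mul (hLB' 1 j)).sub
      (((hLc 0).div (hLc 1) fun s => hL0 s 1).mul
        (continuous_finsetProd _ fun j _ => (hLB' 0 j).mul (hLa 1 j)))
  have key := eq_of_tendsto_of_ae hall hlhs (hrhs.tendsto 0) (by
    filter_upwards [hev] with s ⟨hP, hs⟩ ⟨h₁₂, h₁₃, h₂₃, h₁, h₂, h₃, h₄, h₅⟩
    refine contourIntegral_thetaIntegrand_of_generic hq hq0 ha (hB0 s) (hL0 s) ?_ ?_ hP
      h₁₂ h₁₃ h₂₃ h₁ h₂ h₃ h₄ h₅ (hγs s hs)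
    · rw [Finset.prod_mul_distrib, hbal₁, Fin.prod_univ_three fun j => Complex.exp _, hLB,
        mul_one]
    · rw [Finset.prod_mul_distrib, Fin.prod_univ_three fun j => Complex.exp _, hmB, mul_one,
        hbal₂])
  rwa [hBz, hLz] at key

end

/-! ### The integral evaluation -/

theorem mainTheorem9 (q : ℂ) (hq0 : 0 < ‖q‖) (hq1 : ‖q‖ < 1)
    (a b lam : Fin 3 → ℂ) (ha : ∀ j, a j ≠ 0) (hb : ∀ j, b j ≠ 0)
    (hbal₁ : ∏ j, lam j = q * ∏ j, a j)
    (hbal₂ : q * ∏ j, a j = q ^ 2 / ∏ j, b j)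
    (hab : ∀ (i j : Fin 3) (k : ℕ), a i * b j * q ^ k ≠ 1)
    (hlam : ∀ k : ℤ, lam 0 / lam 1 ≠ q ^ k)
    {p : ℂ} (γ : Path p p) (hγ : IsSeparatingContour q a b γ) :
    (2 * Real.pi * Complex.I)⁻¹ *
        contourIntegral (fun z =>
          (∏ j, qTheta q (lam j * z) / (qPochInf q (a j * z) * qPochInf q (b j / z))) / z) γ
      = 1 / (qPochInf q q * qTheta q (lam 0 / lam 1) * ∏ i, ∏ j, qPochInf q (a i * b j)) *
        ((∏ j, qTheta q (lam 0 / a j) * qTheta q (lam 1 * b j))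
          - lam 0 / lam 1 * ∏ j, qTheta q (lam 0 * b j) * qTheta q (lam 1 / a j)) := by
  have hq : q ≠ 0 := norm_pos_iff.1 hq0
  have ha' : ∏ j, a j ≠ 0 := Finset.prod_ne_zero_iff.2 fun j _ => ha j
  have hb' : ∏ j, b j ≠ 0 := Finset.prod_ne_zero_iff.2 fun j _ => hb j
  have hl : ∀ j, lam j ≠ 0 := fun j =>
    Finset.prod_ne_zero_iff.1 (hbal₁ ▸ mul_ne_zero hq ha') j (Finset.mem_univ j)
  have hbal : (∏ j, a j) * ∏ j, b j = q := by
    rw [eq_div_iff hb', mul_assoc, sq] at hbal₂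
    exact mul_left_cancel₀ hq hbal₂
  have hab' : ∀ i j, qPochInf q (a i * b j) ≠ 0 := fun i j h => by
    obtain ⟨k, hk⟩ := (qPochInf_eq_zero_iff hq1 _).1 h
    exact hab i j k hk
  have h1 := qPochInf_self_ne_zero hq1
  have h2 := qTheta_ne_zero hq1 hq (div_ne_zero (hl 0) (hl 1)) hlam
  have h3 : ∏ i, ∏ j, qPochInf q (a i * b j) ≠ 0 :=
    Finset.prod_ne_zero_iff.2 fun i _ => Finset.prod_ne_zero_iff.2 fun j _ => hab' i j
  rw [← contourIntegral_thetaIntegrand hq1 hq ha hb hl hbal₁ hbal hab' hγ, one_div,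
    eq_inv_mul_iff_mul_eq₀ (mul_ne_zero (mul_ne_zero h1 h2) h3)]
  unfold thetaIntegrand
  ring
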